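/- **Theorem 3.8.** Let $R\in\mathbb{C}[x_1,x_2]$ be a nonzero polynomial without constant term and without linear terms, let $A=\mathbb{C}[x_1,x_2]/(R)$, and let $A_+\subset A$ be the non-unital subalgebra of classes of polynomials without constant term. For $n\ge 1$ let $C_n=A_+^{\otimes n}$ (tensor product over $\mathbb{C}$), with differential $d:C_{n}\to C_{n-1}$, $$d(a_1\otimes\cdots\otimes a_n)=\sum_{i=1}^{n-1}(-1)^{i-1}\,a_1\otimes\cdots\otimes a_ia_{i+1}\otimes\cdots\otimes a_n ,$$ (so $d=0$ on $C_1$), and let $\mathrm{Hoch}_n$ be its homology in degree $n$. Let $e_n(k)$ be the Barr–Gerstenhaber–Schack idempotents, given by $$\sum_{k}x^k e_n(k)=\frac1{n!}\sum_{\sigma\in S_n}(x-d_\sigma)(x-d_\sigma+1)\cdots(x-d_\sigma+n-1)\,\mathrm{sgn}(\sigma)\,\sigma ,$$ where $d_\sigma$ is the number of descents $\sigma(i)>\sigma(i+1)$ and $\sigma$ acts on $C_n$ by moving the factor in position $i$ to position $\sigma(i)$. They commute with $d$; let $C_{n,k}=e_n(k)C_n$ and let $H_{n,k}$ be the homology in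 degree $n$ of the subcomplex $C_{\bullet,k}$. Then for every $k\ge 1$ the maps into homology induced by the inclusions $C_{\bullet,j}\subset C_\bullet$ are injective for the components named below and give $$\mathrm{Hoch}_{2k}=H_{2k,k}\oplus H_{2k,k+1},\qquad \dim_{\mathbb C}H_{2k,k}=\dim_{\mathbb C}H_{2k,k+1}=1,$$ $$\mathrm{Hoch}_{2k-1}=H_{2k-1,k},\qquad \dim_{\mathbb C}H_{2k-1,k}=2,$$ and all other components $H_{2k,j}$ and $H_{2k-1,j}$ vanish. Moreover, there are polynomials $R_1,R_2$ without constant term with $R=x_1R_1+x_2R_2$, and for every such choice the following holds. Define the rows of chains $P^n=(P^n_1,P^n_2)$, $n\ge1$, with $P^n_i\in C_n$, by $P^1=(x_1,x_2)$ and $P^{n+1}=P^n\otimes M_n$ (matrix product with entries multiplied by $\otimes$), where $$M_n=\begin{pmatrix}R_1&-x_2\\ R_2&x_1\end{pmatrix}\ (n\text{ odd}),\qquad M_n=\begin{pmatrix}x_1&x_2\\ -R_2&R_1\end{pmatrix}\ (n\text{ even}).$$ Then for every $n\ge1$ the chains $P^n_1,P^n_2$ are closed and their classes form a basis of $\mathrm{Hoch}_n$.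 For every $k\ge 1$ the chains $e_{2k}(k)P^{2k}_1$, $e_{2k}(k+1)P^{2k}_2$ and $e_{2k-1}(k)P^{2k-1}_1,\ e_{2k-1}(k)P^{2k-1}_2$ are closed, and their classes form bases of $H_{2k,k}$, $H_{2k,k+1}$ and $H_{2k-1,k}$ respectively. -/

import Mathlib

open scoped TensorProduct

noncomputable section

namespace PlaneCurve

section BarComplex

/-! The modified Hochschild complex of a non-unital commutative `ℂ`-algebra `N`.
The `n`-chains are the `n`-fold tensor power `⨂[ℂ]^n N`. -/

variable (N : Type*) [NonUnitalCommRing N] [Module ℂ N] [IsScalarTower ℂ N N]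
  [SMulCommClass ℂ N N]

/-- Contracting a tuple is affected in a single slot, and linearly, when one entry changes. -/
theorem contractNth_update {n : ℕ} (j : Fin n) (a : Fin (n + 1) → N) (p : Fin (n + 1)) :
    ∃ (q : Fin n) (g : N →ₗ[ℂ] N), ∀ v : N,
      Fin.contractNth j.castSucc (· * ·) (Function.update a p v) =
        Function.update (Fin.contractNth j.castSucc (· * ·) a) q (g v) := by
  rcases lt_trichotomy p.val j.val with h | h | h
  · refine ⟨⟨p.val, by omega⟩, LinearMap.id, fun v => funext fun k => ?_⟩
    simp only [Fin.contractNth, Function.update_apply, Fin.ext_iff, Fin.val_castSucc,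
      Fin.val_succ, LinearMap.id_apply]
    split_ifs <;> first | rfl | omega
  · refine ⟨j, { toFun := fun v => v * a j.succ
                 map_add' := fun v w => add_mul v w _
                 map_smul' := fun r v => smul_mul_assoc r v _ }, fun v => funext fun k => ?_⟩
    simp only [Fin.contractNth, Function.update_apply, Fin.ext_iff, Fin.val_castSucc,
      Fin.val_succ, LinearMap.coe_mk, AddHom.coe_mk]
    split_ifs with h1 h2 h3 h4 h5 <;> first | rfl | omega | skip
    all_goals
      have hk : k = j := Fin.ext (by omega)
      subst hk
      rfl
  · by_cases h' : p.val = j.val + 1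
    · refine ⟨j, { toFun := fun v => a j.castSucc * v
                   map_add' := fun v w => mul_add _ v w
                   map_smul' := fun r v => mul_smul_comm r _ v }, fun v => funext fun k => ?_⟩
      simp only [Fin.contractNth, Function.update_apply, Fin.ext_iff, Fin.val_castSucc,
        Fin.val_succ, LinearMap.coe_mk, AddHom.coe_mk]
      split_ifs with h1 h2 h3 h4 h5 <;> first | rfl | omega | skip
      all_goals
        have hk : k = j := Fin.ext (by omega)
        subst hk
        rfl
    · refine ⟨⟨p.val - 1, by omega⟩, LinearMap.id, fun v => funext fun k => ?_⟩
      simp only [Fin.contractNth, Function.update_apply, Fin.ext_iff, Fin.val_castSucc,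
        Fin.val_succ, LinearMap.id_apply]
      split_ifs <;> first | rfl | omega

/-- `(a₀, …, aₙ) ↦ a₀ ⊗ ⋯ ⊗ aⱼaⱼ₊₁ ⊗ ⋯ ⊗ aₙ`, as a multilinear map. -/
def faceMultilinear (n : ℕ) (j : Fin n) :
    MultilinearMap ℂ (fun _ : Fin (n + 1) => N) (⨂[ℂ]^n N) :=
  MultilinearMap.mk'
    (fun a => PiTensorProduct.tprod ℂ (Fin.contractNth j.castSucc (· * ·) a))
    (by
      intro a p v w
      obtain ⟨q, g, hg⟩ := contractNth_update N j a p
      rw [hg, hg, hg, map_add, MultilinearMap.map_update_add])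
    (by
      intro a p r v
      obtain ⟨q, g, hg⟩ := contractNth_update N j a p
      rw [hg, hg, map_smul, MultilinearMap.map_update_smul])

/-- The linear map `a₀ ⊗ ⋯ ⊗ aₙ ↦ a₀ ⊗ ⋯ ⊗ aⱼaⱼ₊₁ ⊗ ⋯ ⊗ aₙ`. -/
def face (n : ℕ) (j : Fin n) : (⨂[ℂ]^(n + 1) N) →ₗ[ℂ] (⨂[ℂ]^n N) :=
  PiTensorProduct.lift (faceMultilinear N n j)

/-- The differential
`a₀ ⊗ ⋯ ⊗ aₙ ↦ a₀a₁ ⊗ a₂ ⊗ ⋯ - a₀ ⊗ a₁a₂ ⊗ ⋯ + ⋯` from `(n+1)`-chains to `n`-chains. -/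
def d (n : ℕ) : (⨂[ℂ]^(n + 1) N) →ₗ[ℂ] (⨂[ℂ]^n N) :=
  ∑ j : Fin n, ((-1 : ℂ) ^ (j : ℕ)) • face N n j

/-- Closed `n`-chains. -/
def cycles : (n : ℕ) → Submodule ℂ (⨂[ℂ]^n N)
  | 0 => ⊤
  | n + 1 => LinearMap.ker (d N n)

/-- Exact `n`-chains. -/
def boundaries (n : ℕ) : Submodule ℂ (⨂[ℂ]^n N) := LinearMap.range (d N n)

/-- `Hoch_n`: closed `n`-chains modulo exact ones (every exact chain is closed, as `d ∘ d = 0`). -/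
abbrev Hoch (n : ℕ) : Type _ := cycles N n ⧸ (boundaries N n).submoduleOf (cycles N n)

/-! The Barr--Gerstenhaber--Schack decomposition. -/

/-- The number of descents `σ(i) > σ(i+1)` of a permutation. -/
def descents {n : ℕ} (σ : Equiv.Perm (Fin n)) : ℕ :=
  Fintype.card {i : Fin n // ∃ h : (i : ℕ) + 1 < n, σ ⟨(i : ℕ) + 1, h⟩ < σ i}

/-- The coefficient of `x ^ k` in `(x - m) (x - m + 1) ⋯ (x - m + n - 1)`. -/
def garsiaCoeff (n m k : ℕ) : ℂ :=
  (∏ i ∈ Finset.range n,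
    (Polynomial.X - Polynomial.C (m : ℂ) + Polynomial.C (i : ℂ))).coeff k

/-- The idempotent `e_n(k)` acting on `n`-chains, given by Garsia's generating function
`∑ₖ xᵏ e_n(k) = (1/n!) ∑_σ (x - d_σ) (x - d_σ + 1) ⋯ (x - d_σ + n - 1) sgn(σ) σ`.
A permutation `σ` moves the factor in position `i` to position `σ i`. -/
def e (n k : ℕ) : (⨂[ℂ]^n N) →ₗ[ℂ] (⨂[ℂ]^n N) :=
  ((Nat.factorial n : ℂ)⁻¹) • ∑ σ : Equiv.Perm (Fin n),
    (garsiaCoeff n (descents σ) k * ((Equiv.Perm.sign σ : ℤ) : ℂ)) •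
      (PiTensorProduct.reindex ℂ (fun _ : Fin n => N) σ).toLinearMap

/-- The component `C_{n,k} = e_n(k) C_n` of the space of `n`-chains. -/
def comp (n k : ℕ) : Submodule ℂ (⨂[ℂ]^n N) := LinearMap.range (e N n k)

/-- Closed chains in `C_{n,k}`. -/
def cyclesComp (n k : ℕ) : Submodule ℂ (⨂[ℂ]^n N) := cycles N n ⊓ comp N n k

/-- The image `d C_{n+1,k}` of the differential on the `k`-th component. -/
def boundariesComp (n k : ℕ) : Submodule ℂ (⨂[ℂ]^n N) := (comp N (n + 1) k).map (d N n)

/-- `H_{n,k}`: the homology in degree `n` of the `k`-th component `C_{•,k}`, a subcomplex because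
`d ∘ e_{n+1}(k) = e_n(k) ∘ d`. -/
abbrev HComp (n k : ℕ) : Type _ :=
  cyclesComp N n k ⧸ (boundariesComp N n k).submoduleOf (cyclesComp N n k)

theorem boundariesComp_le (n k : ℕ) : boundariesComp N n k ≤ boundaries N n :=
  LinearMap.map_le_range

theorem cyclesComp_le (n k : ℕ) : cyclesComp N n k ≤ cycles N n := inf_le_left

/-- The map `H_{n,k} → Hoch_n` induced by the inclusion of chains. -/
def toHoch (n k : ℕ) : HComp N n k →ₗ[ℂ] Hoch N n :=
  Submodule.mapQ _ _ (Submodule.inclusion (cyclesComp_le N n k))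
    (fun _ hz => boundariesComp_le N n k hz)

/-- The class in `Hoch_n` of a closed chain. -/
def hochClass (n : ℕ) (z : ⨂[ℂ]^n N) (hz : z ∈ cycles N n) : Hoch N n :=
  Submodule.Quotient.mk ⟨z, hz⟩

/-- The class in `H_{n,k}` of a closed chain of `C_{n,k}`. -/
def compClass (n k : ℕ) (z : ⨂[ℂ]^n N) (hz : z ∈ cyclesComp N n k) : HComp N n k :=
  Submodule.Quotient.mk ⟨z, hz⟩

/-- `c ⊗ a` for an `n`-chain `c` and an element `a`. -/
def snoc {n : ℕ} (c : ⨂[ℂ]^n N) (a : N) : ⨂[ℂ]^(n + 1) N :=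
  TensorPower.mulEquiv (c ⊗ₜ[ℂ] (PiTensorProduct.tprod ℂ (fun _ : Fin 1 => a)))

/-- The `2 × 2` matrices `M_n`, depending on the parity of `n`. -/
def M (x r : Fin 2 → N) (n : ℕ) : Matrix (Fin 2) (Fin 2) N :=
  if Odd n then !![r 0, -x 1; r 1, x 0] else !![x 0, x 1; -r 1, r 0]

/-- The rows of chains `P¹ = (x₁, x₂)`, `Pⁿ⁺¹ = Pⁿ ⊗ M_n` (the value at `0` is not used). -/
def P (x r : Fin 2 → N) : (n : ℕ) → Fin 2 → ⨂[ℂ]^n N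
  | 0 => 0
  | 1 => fun j => PiTensorProduct.tprod ℂ (fun _ : Fin 1 => x j)
  | n + 2 => fun j => ∑ i : Fin 2, snoc N (P x r (n + 1) i) (M N x r (n + 1) i j)

end BarComplex

section Curve

/-- The polynomials in two variables without constant term. -/
def maxIdeal : Ideal (MvPolynomial (Fin 2) ℂ) :=
  Ideal.span {MvPolynomial.X 0, MvPolynomial.X 1}

/-- The coordinate algebra `ℂ[x₁, x₂] / (R)`. -/
abbrev CoordRing (R : MvPolynomial (Fin 2) ℂ) : Type :=
  MvPolynomial (Fin 2) ℂ ⧸ Ideal.span {R}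

/-- The non-unital subalgebra `A₊` of positive degree: the classes of polynomials
without constant term. -/
def Aplus (R : MvPolynomial (Fin 2) ℂ) : NonUnitalSubalgebra ℂ (CoordRing R) :=
  { (maxIdeal.map (Ideal.Quotient.mk (Ideal.span {R}))).restrictScalars ℂ with
    mul_mem' := fun {_ _} _ hb =>
      (maxIdeal.map (Ideal.Quotient.mk (Ideal.span {R}))).mul_mem_left _ hb }

/-- The class in `A₊` of a polynomial without constant term. -/
def cl (R : MvPolynomial (Fin 2) ℂ) (f : maxIdeal) : Aplus R :=
  ⟨Ideal.Quotient.mk (Ideal.span {R}) f, Ideal.mem_map_of_mem _ f.2⟩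

/-- The coordinates, as polynomials without constant term. -/
def coord (i : Fin 2) : maxIdeal :=
  ⟨MvPolynomial.X i, Ideal.subset_span (by fin_cases i <;> simp)⟩

/-- The two chains `Pⁿ` of the curve `R = 0`, where `R = x₁R₁ + x₂R₂`. -/
def curveP (R : MvPolynomial (Fin 2) ℂ) (S : Fin 2 → maxIdeal) (n : ℕ) :
    Fin 2 → ⨂[ℂ]^n (Aplus R) :=
  P (Aplus R) (fun i => cl R (coord i)) (fun i => cl R (S i)) n

end Curve

end PlaneCurve

end

/-!
For a totally ordered finite set of `M` colours, the signed sum over all `M`-colourings of the `n`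
tensor factors of the permutations sorting the colours is the Adams operation
`ψ^M = ∑ k, M ^ k • e_n(k)`. It commutes with `d`, and `ψ^M ψ^M' = ψ^(MM')`; comparing powers of
`M` shows that the `e_n(k)` commute with `d` and project onto the eigenspaces of the `ψ^M`.

Since `R` has no constant and no linear term, `R = x₁ R₁ + x₂ R₂` with `R₁, R₂` in the maximal
ideal, and `(M_n, M_{n+1})` is a matrix factorization of `R`. It gives a periodic free resolution of
rank two which becomes zero after reduction at the origin, so `dim Hoch_n ≤ 2`.

Let `L` be a linear form on `ℂ[x₁, x₂]` with `L (R h) = h 0`, and contract the last two factors of a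
chain with the symmetric form `(f, g) ↦ L (f g)`, which is well defined on `A_+`. This lowers
`P^{n+2}` to `P^n` and `ψ^M` to `M ψ^M`. Together with the coordinate forms in low degrees it
shows that the rows `P^n` are independent in homology, and it reads off their weights.
-/

noncomputable section

namespace PlaneCurve

open Equiv PiTensorProduct
open scoped Finset

section SortingPermutations

variable {α β : Type*} [LinearOrder α] [LinearOrder β] {n : ℕ}

theorem eq_sort_iff_strictMono {c : Fin n → α} {σ : Perm (Fin n)} :
    σ = Tuple.sort c ↔ StrictMono fun i => toLex (c (σ i), σ i) :=
  Tuple.eq_sort_iff'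

theorem strictMono_sort (c : Fin n → α) :
    StrictMono fun i => toLex (c (Tuple.sort c i), Tuple.sort c i) :=
  eq_sort_iff_strictMono.1 rfl

theorem sort_comp_orderIso (f : α ≃o β) (c : Fin n → α) :
    Tuple.sort (f ∘ c) = Tuple.sort c := by
  refine (eq_sort_iff_strictMono.2 fun i j hij => ?_).symm
  simpa [Prod.Lex.toLex_lt_toLex] using strictMono_sort c hij

theorem sort_mul_sort (c : Fin n → α) (c' : Fin n → β) :
    Tuple.sort c * Tuple.sort c' =
      Tuple.sort fun p => toLex (c' ((Tuple.sort c)⁻¹ p), c p) := by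
  refine eq_sort_iff_strictMono.2 fun i j hij => ?_
  have hlt := Prod.Lex.toLex_lt_toLex.1 (strictMono_sort c' hij)
  simp only [Perm.mul_apply, Perm.inv_def, Equiv.symm_apply_apply, Prod.Lex.toLex_lt_toLex]
  rcases hlt with hlt | ⟨heq, hlt⟩
  · exact Or.inl (Or.inl hlt)
  · rcases Prod.Lex.toLex_lt_toLex.1 (strictMono_sort c hlt) with h | h
    · exact Or.inl (Or.inr ⟨heq, h⟩)
    · exact Or.inr ⟨by simp only at heq h; rw [heq, h.1], h.2⟩

theorem sort_comp_swap (c : Fin (n + 1) → α) {j : Fin n} (h : c j.castSucc ≠ c j.succ) :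
    Tuple.sort (c ∘ swap j.castSucc j.succ) = swap j.castSucc j.succ * Tuple.sort c := by
  refine (eq_sort_iff_strictMono.2 fun x y hxy => ?_).symm
  have hlt := strictMono_sort c hxy
  simp only [Perm.mul_apply, Function.comp_apply, swap_apply_self,
    Prod.Lex.toLex_lt_toLex] at hlt ⊢
  refine hlt.imp_right fun ⟨heq, hpq⟩ => ⟨heq, ?_⟩
  generalize Tuple.sort c x = p at heq hpq ⊢
  generalize Tuple.sort c y = q at heq hpq ⊢
  have hne : ¬ (p = j.castSucc ∧ q = j.succ) := by
    rintro ⟨rfl, rfl⟩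
    exact h heq
  simp only [swap_apply_def, Fin.ext_iff, Fin.lt_def, Fin.val_castSucc, Fin.val_succ] at *
  split_ifs <;> (try simp only [Fin.val_castSucc, Fin.val_succ]) <;> omega

/-- The permutation of `Fin (n + 1)` that sends `i` to `j` and is the given permutation of `Fin n`
on the remaining positions, renumbered in increasing order. -/
def insertPerm (i j : Fin (n + 1)) (s : Perm (Fin n)) : Perm (Fin (n + 1)) :=
  (Fin.cycleRange j)⁻¹ * Perm.decomposeFin.symm (0, s) * Fin.cycleRange i

@[simp] theorem insertPerm_self (i j : Fin (n + 1)) (s : Perm (Fin n)) :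
    insertPerm i j s i = j := by
  simp [insertPerm, Perm.mul_apply, Perm.inv_def]

@[simp] theorem insertPerm_succAbove (i j : Fin (n + 1)) (s : Perm (Fin n)) (x : Fin n) :
    insertPerm i j s (i.succAbove x) = j.succAbove (s x) := by
  simp [insertPerm, Perm.mul_apply, Perm.inv_def]

theorem insertPerm_inv_self (i j : Fin (n + 1)) (s : Perm (Fin n)) :
    (insertPerm i j s)⁻¹ j = i := by
  rw [Perm.inv_eq_iff_eq, insertPerm_self]

theorem insertPerm_inv_succAbove (i j : Fin (n + 1)) (s : Perm (Fin n)) (x : Fin n) :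
    (insertPerm i j s)⁻¹ (j.succAbove x) = i.succAbove (s⁻¹ x) := by
  rw [Perm.inv_eq_iff_eq, insertPerm_succAbove, Perm.inv_def, Equiv.apply_symm_apply]

theorem sign_insertPerm (i j : Fin (n + 1)) (s : Perm (Fin n)) :
    Perm.sign (insertPerm i j s) = (-1) ^ ((i : ℕ) + j) * Perm.sign s := by
  simp only [insertPerm, Perm.sign_mul, Perm.sign_inv, Fin.sign_cycleRange,
    Perm.decomposeFin.symm_sign, if_true, one_mul, pow_add]
  rw [mul_comm, ← mul_assoc]

theorem predAbove_succ_succAbove (j x : Fin n) : j.predAbove (j.succ.succAbove x) = x := by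
  rcases le_or_gt x j with h | h
  · rw [Fin.succAbove_of_castSucc_lt _ _ (Fin.castSucc_lt_succ_iff.2 h),
      Fin.predAbove_castSucc_of_le _ _ h]
  · rw [Fin.succAbove_of_le_castSucc _ _ (Fin.succ_le_castSucc_iff.2 h),
      Fin.predAbove_succ_of_le _ _ h.le]

theorem predAbove_insertPerm (s : Perm (Fin n)) (i : Fin n) (x : Fin (n + 1)) :
    (s i).predAbove (insertPerm i.succ (s i).succ s x) = s (i.predAbove x) := by
  obtain rfl | ⟨y, rfl⟩ := Fin.eq_self_or_eq_succAbove i.succ x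
  · simp
  · simp [predAbove_succ_succAbove]

theorem eq_castSucc_succ_of_predAbove_eq {i : Fin n} {x y : Fin (n + 1)} (hxy : x < y)
    (h : i.predAbove x = i.predAbove y) : x = i.castSucc ∧ y = i.succ := by
  simp only [Fin.predAbove, Fin.lt_def, Fin.ext_iff, Fin.val_castSucc, Fin.val_succ] at *
  split_ifs at h <;> simp only [Fin.val_pred, Fin.coe_castPred] at h <;> omega

theorem sort_comp_predAbove (c : Fin n → α) (i : Fin n) :
    Tuple.sort (c ∘ (Tuple.sort c i).predAbove) =
      insertPerm i.succ (Tuple.sort c i).succ (Tuple.sort c) := by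
  refine (eq_sort_iff_strictMono.2 fun x y hxy => ?_).symm
  simp only [Function.comp_apply, predAbove_insertPerm, Prod.Lex.toLex_lt_toLex]
  rcases (Fin.predAbove_right_monotone i hxy.le).lt_or_eq with hlt | heq
  · refine (Prod.Lex.toLex_lt_toLex.1 (strictMono_sort c hlt)).imp_right fun ⟨hc, hs⟩ => ⟨hc, ?_⟩
    simp only [← predAbove_insertPerm] at hs
    exact (Fin.predAbove_right_monotone _).reflect_lt hs
  · obtain ⟨rfl, rfl⟩ := eq_castSucc_succ_of_predAbove_eq hxy heq
    refine Or.inr ⟨by rw [heq], ?_⟩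
    rw [insertPerm_self, show i.castSucc = i.succ.succAbove i by simp, insertPerm_succAbove]
    simp

theorem exists_eq_insertPerm (σ : Perm (Fin (n + 1))) (i : Fin (n + 1)) :
    ∃ s : Perm (Fin n), σ = insertPerm i (σ i) s := by
  have hne (x : Fin n) : σ (i.succAbove x) ≠ σ i := σ.injective.ne (Fin.succAbove_ne i x)
  choose f hf using fun x => Fin.exists_succAbove_eq (hne x)
  have hinj : Function.Injective f := fun x y hxy =>
    Fin.succAbove_right_injective (σ.injective (by rw [← hf, ← hf, hxy]))
  refine ⟨Equiv.ofBijective f (Finite.injective_iff_bijective.1 hinj), Equiv.ext fun x => ?_⟩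
  obtain rfl | ⟨y, rfl⟩ := Fin.eq_self_or_eq_succAbove i x
  · simp
  · simp [hf]

theorem sort_eq_insertPerm_last (c : Fin (n + 1) → α) {i : Fin (n + 1)}
    (h : Tuple.sort c i = Fin.last n) :
    Tuple.sort c = insertPerm i (Fin.last n) (Tuple.sort (c ∘ Fin.castSucc)) := by
  obtain ⟨s, hs⟩ := exists_eq_insertPerm (Tuple.sort c) i
  rw [h] at hs
  have hsucc (x : Fin n) : Tuple.sort c (i.succAbove x) = (s x).castSucc := by simp [hs]
  rw [hs]
  congr 1
  refine eq_sort_iff_strictMono.2 fun x y hxy => ?_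
  simpa [hsucc, Prod.Lex.toLex_lt_toLex] using
    strictMono_sort c (Fin.strictMono_succAbove i hxy)

end SortingPermutations

section SignedSums

variable {n : ℕ}

/-- The sign of a permutation, as a complex number. -/
def sgn : Perm (Fin n) →* ℂ :=
  (Int.castRingHom ℂ : ℤ →* ℂ).comp ((Units.coeHom ℤ).comp Perm.sign)

theorem sgn_apply (s : Perm (Fin n)) : sgn s = ((Perm.sign s : ℤ) : ℂ) := rfl

theorem sgn_mul_self (s : Perm (Fin n)) : sgn s * sgn s = 1 := by
  rw [sgn_apply, ← Int.cast_mul, ← Units.val_mul, Int.units_mul_self, Units.val_one, Int.cast_one]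

theorem sgn_insertPerm (i j : Fin (n + 1)) (s : Perm (Fin n)) :
    sgn (insertPerm i j s) = (-1) ^ ((i : ℕ) + j) * sgn s := by
  simp [sgn_apply, sign_insertPerm]

theorem comp_predAbove_comp_succAbove {α : Type*} (c : Fin n → α) (j : Fin n) :
    (c ∘ j.predAbove) ∘ j.succ.succAbove = c := by
  funext x
  simp [predAbove_succ_succAbove]

theorem comp_succAbove_comp_predAbove {α : Type*} {c : Fin (n + 1) → α} {j : Fin n}
    (h : c j.castSucc = c j.succ) : (c ∘ j.succ.succAbove) ∘ j.predAbove = c := by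
  funext x
  obtain rfl | ⟨y, rfl⟩ := Fin.eq_self_or_eq_succAbove j.succ x
  · simpa using h
  · simp [predAbove_succ_succAbove]

variable {α V : Type*} [LinearOrder α] [Fintype α] [AddCommGroup V] [Module ℂ V]

theorem sum_sgn_sort_ne_eq_zero (j : Fin n) (F : Perm (Fin (n + 1)) → V)
    (hF : ∀ s, F (swap j.castSucc j.succ * s) = F s) :
    ∑ c : Fin (n + 1) → α with c j.castSucc ≠ c j.succ,
      sgn (Tuple.sort c) • F (Tuple.sort c) = 0 := by
  refine Finset.sum_involution (fun c _ => c ∘ swap j.castSucc j.succ) ?_ ?_ ?_ ?_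
  · intro c hc
    have hswap : sgn (swap j.castSucc j.succ) = -1 := by
      rw [sgn_apply, Perm.sign_swap (by simp [Fin.ext_iff])]
      simp
    rw [sort_comp_swap c (Finset.mem_filter.1 hc).2, hF, map_mul, hswap]
    simp
  · intro c hc _ h
    exact (Finset.mem_filter.1 hc).2 (by simpa using congrFun h j.succ)
  · intro c hc
    simpa using (Finset.mem_filter.1 hc).2.symm
  · intro c _
    funext x
    simp

/-- The colourings with different colours in positions `j` and `j + 1` cancel in pairs. -/
theorem sum_sgn_sort (j : Fin n) (F : Perm (Fin (n + 1)) → V)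
    (hF : ∀ s, F (swap j.castSucc j.succ * s) = F s) :
    ∑ c : Fin (n + 1) → α, sgn (Tuple.sort c) • F (Tuple.sort c) =
      ∑ c : Fin n → α, ((-1) ^ (((Tuple.sort c)⁻¹ j : ℕ) + j) * sgn (Tuple.sort c)) •
        F (insertPerm ((Tuple.sort c)⁻¹ j).succ j.succ (Tuple.sort c)) := by
  rw [← Finset.sum_filter_add_sum_filter_not Finset.univ
    (fun c : Fin (n + 1) → α => c j.castSucc = c j.succ), sum_sgn_sort_ne_eq_zero j F hF, add_zero]
  symm
  refine Finset.sum_bij' (fun c _ => c ∘ j.predAbove) (fun c _ => c ∘ j.succ.succAbove)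
    (by simp) (by simp) (fun c _ => comp_predAbove_comp_succAbove c j)
    (fun c hc => comp_succAbove_comp_predAbove (Finset.mem_filter.1 hc).2) fun c _ => ?_
  have hsort := sort_comp_predAbove c ((Tuple.sort c)⁻¹ j)
  rw [Perm.inv_def, Equiv.apply_symm_apply, ← Perm.inv_def] at hsort
  rw [hsort, sgn_insertPerm]
  congr 2
  simp only [Fin.val_succ]
  ring

end SignedSums

section CountingColourings

variable {m : ℕ} (D : Fin m → Prop) [DecidablePred D]

/-- The number of steps before position `i` at which a tuple may stay constant, when `D` is the set
of steps at which it has to increase. Adding it turns such tuples into strictly increasing ones. -/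
def weakSteps (i : Fin (m + 1)) : ℕ := #{j : Fin m | j.castSucc < i ∧ ¬ D j}

theorem weakSteps_zero : weakSteps D 0 = 0 := by simp [weakSteps]

theorem weakSteps_succ (i : Fin m) :
    weakSteps D i.succ = weakSteps D i.castSucc + if D i then 0 else 1 := by
  have hsplit : (Finset.univ.filter fun j : Fin m => j.castSucc < i.succ ∧ ¬ D j) =
      (Finset.univ.filter fun j : Fin m => j.castSucc < i.castSucc ∧ ¬ D j) ∪
        (if D i then ∅ else {i}) := by
    ext j
    have hlt : j.castSucc < i.succ ↔ j.castSucc < i.castSucc ∨ j = i := by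
      rw [Fin.castSucc_lt_succ_iff, Fin.castSucc_lt_castSucc_iff, le_iff_lt_or_eq]
    by_cases hi : D i <;> by_cases hj : j = i <;> simp_all
  rw [weakSteps, hsplit, Finset.card_union_of_disjoint (by split_ifs <;> simp), weakSteps]
  split_ifs <;> rfl

theorem weakSteps_last : weakSteps D (Fin.last m) + #{j | D j} = m := by
  have h := Finset.card_filter_add_card_filter_not (s := (Finset.univ : Finset (Fin m))) D
  simp only [weakSteps, Fin.castSucc_lt_last, true_and]
  simpa [add_comm] using h

theorem strictMono_add_weakSteps_iff (g : Fin (m + 1) → ℕ) :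
    StrictMono (g + weakSteps D) ↔
      ∀ i : Fin m, g i.castSucc ≤ g i.succ ∧ (D i → g i.castSucc < g i.succ) := by
  rw [Fin.strictMono_iff_lt_succ]
  refine forall_congr' fun i => ?_
  simp only [Pi.add_apply, weakSteps_succ]
  split_ifs with h <;> simp only [h, true_imp_iff, false_imp_iff, and_true] <;> omega

theorem monotone_sub_weakSteps {h : Fin (m + 1) → ℕ} (hh : StrictMono h) :
    Monotone fun i => (h i : ℤ) - weakSteps D i := by
  refine Fin.monotone_iff_le_succ.2 fun i => ?_
  have := hh i.castSucc_lt_succ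
  simp only [weakSteps_succ]
  split_ifs <;> push_cast <;> omega

theorem card_fin_orderEmbedding (n N : ℕ) : Nat.card (Fin n ↪o Fin N) = N.choose n := by
  rw [Nat.card_congr Set.powersetCard.ofFinEmbEquiv, Set.powersetCard.card, Nat.card_fin]

theorem card_increasing (M : ℕ) :
    Nat.card {g : Fin (m + 1) → Fin M // ∀ i : Fin m, g i.castSucc ≤ g i.succ ∧
      (D i → g i.castSucc < g i.succ)} = (M + weakSteps D (Fin.last m)).choose (m + 1) := by
  rw [← card_fin_orderEmbedding]
  have hmono (h : Fin (m + 1) ↪o Fin (M + weakSteps D (Fin.last m))) :=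
    monotone_sub_weakSteps D (h := fun i => h i) h.strictMono
  have hnonneg (h : Fin (m + 1) ↪o Fin (M + weakSteps D (Fin.last m))) (i) :
      weakSteps D i ≤ h i := by
    have := hmono h (Fin.zero_le i)
    simp only [weakSteps_zero] at this
    omega
  refine Nat.card_congr
    { toFun := fun g => OrderEmbedding.ofStrictMono
        (fun i => ⟨g.1 i + weakSteps D i, ?_⟩)
        ((strictMono_add_weakSteps_iff D fun i => g.1 i).2 g.2)
      invFun := fun h => ⟨fun i => ⟨h i - weakSteps D i, ?_⟩,
        (strictMono_add_weakSteps_iff D fun i => h i - weakSteps D i).1 ?_⟩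
      left_inv := fun g => by ext i; simp [OrderEmbedding.ofStrictMono]
      right_inv := fun h => by
        ext i; simp [OrderEmbedding.ofStrictMono, Nat.sub_add_cancel (hnonneg h i)] }
  · have := (strictMono_add_weakSteps_iff D fun i => g.1 i).2 g.2 |>.monotone (Fin.le_last i)
    have := (g.1 (Fin.last m)).2
    simp only [Pi.add_apply] at *
    omega
  · have := hmono h (Fin.le_last i)
    have := (h (Fin.last m)).2
    have := hnonneg h i
    simp only at *
    omega
  · rw [show (fun i => (h i : ℕ) - weakSteps D i) + weakSteps D = fun i => (h i : ℕ) from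
      funext fun i => Nat.sub_add_cancel (hnonneg h i)]
    exact h.strictMono

theorem descents_succ (σ : Perm (Fin (m + 1))) :
    descents σ = #{i : Fin m | σ i.succ < σ i.castSucc} := by
  rw [descents, ← Fintype.card_subtype]
  exact Fintype.card_congr
    { toFun := fun i => ⟨⟨i.1, by have := i.2.1; omega⟩, i.2.2⟩
      invFun := fun i => ⟨i.1.castSucc, by simp, i.2⟩
      left_inv := fun i => rfl
      right_inv := fun i => rfl }

theorem descents_le (σ : Perm (Fin (m + 1))) : descents σ ≤ m := by
  rw [descents_succ]
  exact (Finset.card_filter_le _ _).trans (by simp)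

theorem sort_comp_inv_eq_iff {α : Type*} [LinearOrder α] (g : Fin (m + 1) → α)
    (σ : Perm (Fin (m + 1))) : Tuple.sort (g ∘ ⇑σ⁻¹) = σ ↔
      ∀ i : Fin m, g i.castSucc ≤ g i.succ ∧
        (σ i.succ < σ i.castSucc → g i.castSucc < g i.succ) := by
  rw [eq_comm, eq_sort_iff_strictMono, Fin.strictMono_iff_lt_succ]
  refine forall_congr' fun i => ?_
  have hne : σ i.castSucc ≠ σ i.succ := σ.injective.ne i.castSucc_lt_succ.ne
  simp only [Function.comp_apply, Perm.inv_def, Equiv.symm_apply_apply, Prod.Lex.toLex_lt_toLex]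
  grind

theorem card_sort_eq {n : ℕ} (M : ℕ) (σ : Perm (Fin n)) :
    #{c : Fin n → Fin M | Tuple.sort c = σ} = (M + n - 1 - descents σ).choose n := by
  cases n with
  | zero =>
    rw [Nat.choose_zero_right, Finset.card_eq_one]
    exact ⟨Fin.elim0, by ext c; simp [Subsingleton.elim _ σ, eq_iff_true_of_subsingleton]⟩
  | succ m =>
    have hlast := weakSteps_last fun i : Fin m => σ i.succ < σ i.castSucc
    rw [← descents_succ] at hlast
    rw [show M + (m + 1) - 1 - descents σ =
      M + weakSteps (fun i : Fin m => σ i.succ < σ i.castSucc) (Fin.last m) by omega,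
      ← card_increasing, ← Fintype.card_subtype, ← Nat.card_eq_fintype_card]
    refine Nat.card_congr ((σ.arrowCongr (Equiv.refl _)).symm.subtypeEquiv fun c => ?_)
    rw [← sort_comp_inv_eq_iff]
    simp [Function.comp_def, Perm.inv_def]

/-- Garsia's polynomial, whose `k`-th coefficient is `garsiaCoeff n d k`. -/
def garsiaPoly (n d : ℕ) : Polynomial ℂ :=
  ∏ i ∈ Finset.range n, (Polynomial.X - Polynomial.C (d : ℂ) + Polynomial.C (i : ℂ))

theorem natDegree_garsiaPoly_le (n d : ℕ) : (garsiaPoly n d).natDegree ≤ n := by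
  refine (Polynomial.natDegree_prod_le _ _).trans
    ((Finset.sum_le_card_nsmul _ _ 1 fun i _ => ?_).trans (by simp))
  compute_degree

theorem garsiaCoeff_eq_zero {n d k : ℕ} (h : n < k) : garsiaCoeff n d k = 0 :=
  Polynomial.coeff_eq_zero_of_natDegree_lt ((natDegree_garsiaPoly_le n d).trans_lt h)

theorem eval_garsiaPoly_descents {n : ℕ} (M : ℕ) (σ : Perm (Fin n)) :
    (garsiaPoly n (descents σ)).eval (M : ℂ) =
      (n.factorial : ℂ) * #{c : Fin n → Fin M | Tuple.sort c = σ} := by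
  rw [card_sort_eq, garsiaPoly, Polynomial.eval_prod]
  simp only [Polynomial.eval_add, Polynomial.eval_sub, Polynomial.eval_X, Polynomial.eval_C]
  rcases lt_or_ge (descents σ) M with h | h
  · obtain ⟨t, rfl⟩ := Nat.exists_eq_add_of_lt h
    rw [show descents σ + t + 1 + n - 1 - descents σ = t + 1 + n - 1 by omega, ← Nat.cast_mul,
      ← Nat.ascFactorial_eq_factorial_mul_choose', Nat.ascFactorial_eq_prod_range, Nat.cast_prod]
    refine Finset.prod_congr rfl fun i _ => ?_
    push_cast
    ring
  · cases n with
    | zero => simp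
    | succ m =>
      have := descents_le σ
      rw [Nat.choose_eq_zero_of_lt (by omega), Nat.cast_zero, mul_zero]
      refine Finset.prod_eq_zero (i := descents σ - M) (Finset.mem_range.2 (by omega)) ?_
      rw [Nat.cast_sub h]
      ring

theorem sum_pow_mul_garsiaCoeff {n K : ℕ} (M : ℕ) (hK : n < K) (σ : Perm (Fin n)) :
    ∑ k ∈ Finset.range K, (M : ℂ) ^ k * garsiaCoeff n (descents σ) k =
      (n.factorial : ℂ) * #{c : Fin n → Fin M | Tuple.sort c = σ} := by
  rw [← eval_garsiaPoly_descents,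
    Polynomial.eval_eq_sum_range' ((natDegree_garsiaPoly_le n _).trans_lt hK)]
  exact Finset.sum_congr rfl fun k _ => mul_comm _ _

end CountingColourings

section PolynomialIdentities

variable {𝕜 V : Type*} [Field 𝕜] [CharZero 𝕜] [AddCommGroup V] [Module 𝕜 V] {K : ℕ}

theorem eq_zero_of_sum_pow_smul {v : ℕ → V}
    (h : ∀ M : ℕ, ∑ k ∈ Finset.range K, (M : 𝕜) ^ k • v k = 0) {k : ℕ} (hk : k < K) :
    v k = 0 := by
  refine (Module.forall_dual_apply_eq_zero_iff 𝕜 _).1 fun f => ?_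
  let p : Polynomial 𝕜 := ∑ k ∈ Finset.range K, Polynomial.monomial k (f (v k))
  have hp : p = 0 := by
    refine Polynomial.eq_zero_of_infinite_isRoot _
      ((Set.infinite_range_of_injective (Nat.cast_injective (R := 𝕜))).mono ?_)
    rintro _ ⟨M, rfl⟩
    have hM := congrArg f (h M)
    simpa [p, Polynomial.eval_finsetSum, mul_comm] using hM
  have hcoeff := congrArg (Polynomial.coeff · k) hp
  simpa [p, Polynomial.finsetSum_coeff, Polynomial.coeff_monomial, hk] using hcoeff

theorem eq_of_sum_pow_smul {v w : ℕ → V}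
    (h : ∀ M : ℕ, ∑ k ∈ Finset.range K, (M : 𝕜) ^ k • v k =
      ∑ k ∈ Finset.range K, (M : 𝕜) ^ k • w k) {k : ℕ} (hk : k < K) : v k = w k :=
  sub_eq_zero.1 <| eq_zero_of_sum_pow_smul (𝕜 := 𝕜) (v := v - w)
    (fun M => by simp [smul_sub, Finset.sum_sub_distrib, h M]) hk

end PolynomialIdentities

section AdamsOperations

variable (N : Type*) [AddCommMonoid N] [Module ℂ N]

/-- The action of permutations on chains, moving the factor in position `i` to position `s i`. -/
def permute {n : ℕ} : Perm (Fin n) →* Module.End ℂ (⨂[ℂ]^n N) where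
  toFun s := (PiTensorProduct.reindex ℂ (fun _ : Fin n => N) s).toLinearMap
  map_one' := congrArg LinearEquiv.toLinearMap
    (PiTensorProduct.reindex_refl (R := ℂ) (s := fun _ : Fin n => N))
  map_mul' s t := congrArg LinearEquiv.toLinearMap (PiTensorProduct.reindex_trans t s).symm

variable {N} in
theorem permute_tprod {n : ℕ} (s : Perm (Fin n)) (a : Fin n → N) :
    permute N s (tprod ℂ a) = tprod ℂ fun p => a (s⁻¹ p) :=
  PiTensorProduct.reindex_tprod (R := ℂ) (s := fun _ : Fin n => N) s a

/-- The Adams operation `∑_c sgn(s_c) s_c`, where `c` runs over the colourings of the positions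
`1, …, n` by `α` and `s_c` sorts the positions by colour. It depends only on the cardinality `M` of
`α` and equals `∑ₖ Mᵏ e_n(k)`. -/
def adams (α : Type*) [LinearOrder α] [Fintype α] (n : ℕ) : Module.End ℂ (⨂[ℂ]^n N) :=
  ∑ c : Fin n → α, sgn (Tuple.sort c) • permute N (Tuple.sort c)

variable {α β : Type*} [LinearOrder α] [Fintype α] [LinearOrder β] [Fintype β]

theorem adams_congr (f : α ≃o β) (n : ℕ) : adams N α n = adams N β n :=
  Fintype.sum_equiv ((Equiv.refl (Fin n)).arrowCongr f.toEquiv) _ _ fun c => by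
    rw [← sort_comp_orderIso f c]
    rfl

/-- Reading off `c'` in the order sorted by `c`, the pairs of colourings with values in `α` and `β`
are the colourings with values in `β ×ₗ α`. -/
def colouringPairEquiv (α β : Type*) [LinearOrder α] (n : ℕ) :
    (Fin n → α) × (Fin n → β) ≃ (Fin n → β ×ₗ α) where
  toFun c p := toLex (c.2 ((Tuple.sort c.1)⁻¹ p), c.1 p)
  invFun b := (fun p => (ofLex (b p)).2,
    fun p => (ofLex (b (Tuple.sort (fun p => (ofLex (b p)).2) p))).1)
  left_inv c := by simp
  right_inv b := by
    funext p
    simp [Perm.inv_def]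

theorem adams_mul_adams (n : ℕ) : adams N α n * adams N β n = adams N (β ×ₗ α) n := by
  simp only [adams, Finset.sum_mul_sum, smul_mul_smul_comm, ← map_mul]
  rw [← Fintype.sum_prod_type']
  exact Fintype.sum_equiv (colouringPairEquiv α β n) _ _ fun c => by rw [sort_mul_sort]; rfl

theorem adams_fin_mul_adams_fin (M M' n : ℕ) :
    adams N (Fin M) n * adams N (Fin M') n = adams N (Fin (M * M')) n := by
  rw [adams_mul_adams]
  exact (adams_congr N (Fintype.orderIsoFinOfCardEq (Fin M' ×ₗ Fin M)
    (by simp [Fintype.card_lex, mul_comm])) n).symm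

end AdamsOperations

section Idempotents

variable (N : Type*) [NonUnitalCommRing N] [Module ℂ N]

theorem e_eq_zero {n k : ℕ} (h : n < k) : e N n k = 0 := by
  simp [e, garsiaCoeff_eq_zero h]

theorem e_eq_sum_sgn_smul_permute (n k : ℕ) :
    e N n k = ∑ σ : Perm (Fin n),
      ((n.factorial : ℂ)⁻¹ * garsiaCoeff n (descents σ) k) • sgn σ • permute N σ := by
  rw [e, Finset.smul_sum]
  refine Finset.sum_congr rfl fun σ _ => ?_
  rw [mul_smul, mul_smul, sgn_apply]
  rfl

theorem adams_fin_eq_sum_card_smul (M n : ℕ) :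
    adams N (Fin M) n = ∑ σ : Perm (Fin n),
      (#{c : Fin n → Fin M | Tuple.sort c = σ} : ℂ) • sgn σ • permute N σ := by
  rw [adams, ← Finset.sum_fiberwise Finset.univ fun c : Fin n → Fin M => Tuple.sort c]
  refine Finset.sum_congr rfl fun σ _ => ?_
  rw [Finset.sum_congr rfl fun c hc => by rw [(Finset.mem_filter.1 hc).2], Finset.sum_const,
    Nat.cast_smul_eq_nsmul]

theorem sum_pow_smul_e {n K : ℕ} (M : ℕ) (hK : n < K) :
    ∑ k ∈ Finset.range K, (M : ℂ) ^ k • e N n k = adams N (Fin M) n := by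
  simp only [adams_fin_eq_sum_card_smul, e_eq_sum_sgn_smul_permute, Finset.smul_sum]
  rw [Finset.sum_comm]
  refine Finset.sum_congr rfl fun σ _ => ?_
  have hcard := sum_pow_mul_garsiaCoeff M hK σ
  have hfact : (n.factorial : ℂ) ≠ 0 := Nat.cast_ne_zero.2 n.factorial_ne_zero
  simp only [smul_smul _ _ (sgn σ • permute N σ), ← Finset.sum_smul, mul_left_comm _ (_⁻¹),
    ← Finset.mul_sum, hcard, inv_mul_cancel_left₀ hfact]

theorem e_mul_adams_fin (n k M : ℕ) : e N n k * adams N (Fin M) n = (M : ℂ) ^ k • e N n k := by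
  rcases lt_or_ge n k with hk | hk
  · simp [e_eq_zero N hk]
  refine eq_of_sum_pow_smul (𝕜 := ℂ) (v := fun k => e N n k * adams N (Fin M) n)
    (w := fun k => (M : ℂ) ^ k • e N n k) (fun M' => ?_) (Nat.lt_succ_of_le hk)
  simp only [← smul_mul_assoc, ← Finset.sum_mul, smul_smul, ← mul_pow, ← Nat.cast_mul,
    sum_pow_smul_e N _ n.lt_succ_self, adams_fin_mul_adams_fin]

theorem e_mul_e (n j k : ℕ) : e N n j * e N n k = if j = k then e N n k else 0 := by
  rcases lt_or_ge n k with hk | hk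
  · simp [e_eq_zero N hk]
  rcases lt_or_ge n j with hj | hj
  · rw [e_eq_zero N hj, zero_mul, if_neg (by omega)]
  refine eq_of_sum_pow_smul (𝕜 := ℂ) (v := fun k => e N n j * e N n k)
    (w := fun k => if j = k then e N n k else 0) (fun M => ?_) (Nat.lt_succ_of_le hk)
  simp only [← mul_smul_comm, ← Finset.mul_sum, sum_pow_smul_e N M n.lt_succ_self, e_mul_adams_fin]
  simp [Nat.lt_succ_of_le hj]

end Idempotents

section FacesAndPermutations

theorem contractNth_castSucc_apply {A : Type*} (op : A → A → A) {n : ℕ} (j : Fin n)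
    (g : Fin (n + 1) → A) (p : Fin n) :
    Fin.contractNth j.castSucc op g p =
      if p = j then op (g j.castSucc) (g j.succ) else g (j.succ.succAbove p) := by
  split_ifs with h
  · simp [Fin.contractNth, h]
  · simp only [Fin.contractNth, Fin.val_castSucc, Fin.succAbove, Fin.lt_def, Fin.val_succ,
      Fin.ext_iff] at h ⊢
    split_ifs <;> first | rfl | omega

theorem contractNth_comp_swap {A : Type*} [CommMagma A] {n : ℕ} (j : Fin n) (g : Fin (n + 1) → A) :
    Fin.contractNth j.castSucc (· * ·) (g ∘ swap j.castSucc j.succ) =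
      Fin.contractNth j.castSucc (· * ·) g := by
  funext p
  rw [contractNth_castSucc_apply, contractNth_castSucc_apply]
  split_ifs with h
  · simp [mul_comm]
  · rw [Function.comp_apply, swap_apply_of_ne_of_ne _ (Fin.succAbove_ne _ _)]
    rw [← Fin.succAbove_succ_self j]
    exact Fin.succAbove_right_injective.ne h

theorem contractNth_comp_insertPerm_inv {A : Type*} (op : A → A → A) {n : ℕ} (j : Fin n)
    (s : Perm (Fin n)) (a : Fin (n + 1) → A) (p : Fin n) :
    Fin.contractNth j.castSucc op (fun p => a ((insertPerm (s⁻¹ j).succ j.succ s)⁻¹ p)) p =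
      Fin.contractNth (s⁻¹ j).castSucc op a (s⁻¹ p) := by
  have hcast (i : Fin n) : i.castSucc = i.succ.succAbove i := (Fin.succAbove_succ_self i).symm
  rw [contractNth_castSucc_apply, contractNth_castSucc_apply, insertPerm_inv_self, hcast j,
    insertPerm_inv_succAbove, insertPerm_inv_succAbove, ← hcast (s⁻¹ j)]
  simp only [(s⁻¹).injective.eq_iff]

variable (N : Type*) [NonUnitalCommRing N] [Module ℂ N] [IsScalarTower ℂ N N]
  [SMulCommClass ℂ N N]

theorem face_tprod {n : ℕ} (j : Fin n) (a : Fin (n + 1) → N) :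
    face N n j (tprod ℂ a) = tprod ℂ (Fin.contractNth j.castSucc (· * ·) a) :=
  PiTensorProduct.lift.tprod _

theorem face_comp_permute_swap_mul {n : ℕ} (j : Fin n) (s : Perm (Fin (n + 1))) :
    face N n j ∘ₗ permute N (swap j.castSucc j.succ * s) = face N n j ∘ₗ permute N s := by
  ext a
  simp only [LinearMap.compMultilinearMap_apply, LinearMap.comp_apply, permute_tprod, face_tprod]
  rw [← contractNth_comp_swap j fun p => a (s⁻¹ p)]
  rfl

theorem face_comp_permute_insertPerm {n : ℕ} (j : Fin n) (s : Perm (Fin n)) :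
    face N n j ∘ₗ permute N (insertPerm (s⁻¹ j).succ j.succ s) =
      permute N s ∘ₗ face N n (s⁻¹ j) := by
  ext a
  simp only [LinearMap.compMultilinearMap_apply, LinearMap.comp_apply, permute_tprod, face_tprod]
  exact congrArg _ (funext (contractNth_comp_insertPerm_inv _ j s a))

theorem face_comp_adams (α : Type*) [LinearOrder α] [Fintype α] {n : ℕ} (j : Fin n) :
    face N n j ∘ₗ adams N α (n + 1) = ∑ c : Fin n → α,
      ((-1) ^ (((Tuple.sort c)⁻¹ j : ℕ) + j) * sgn (Tuple.sort c)) •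
        permute N (Tuple.sort c) ∘ₗ face N n ((Tuple.sort c)⁻¹ j) := by
  have hsum := sum_sgn_sort (α := α) j (fun s => face N n j ∘ₗ permute N s)
    (face_comp_permute_swap_mul N j)
  simp only [face_comp_permute_insertPerm] at hsum
  rw [← hsum]
  ext a
  simp [adams]

theorem d_comp_adams (α : Type*) [LinearOrder α] [Fintype α] (n : ℕ) :
    d N n ∘ₗ adams N α (n + 1) = adams N α n ∘ₗ d N n := by
  have hface (j : Fin n) : ((-1 : ℂ) ^ (j : ℕ)) • face N n j ∘ₗ adams N α (n + 1) =
      ∑ c : Fin n → α, sgn (Tuple.sort c) • (permute N (Tuple.sort c) ∘ₗ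
        (((-1 : ℂ) ^ ((Tuple.sort c)⁻¹ j : ℕ)) • face N n ((Tuple.sort c)⁻¹ j))) := by
    rw [face_comp_adams, Finset.smul_sum]
    refine Finset.sum_congr rfl fun c _ => ?_
    have hsign : (-1 : ℂ) ^ (j : ℕ) * (-1) ^ (j : ℕ) = 1 := by rw [← mul_pow]; simp
    rw [LinearMap.comp_smul, smul_smul, smul_smul]
    congr 1
    linear_combination (-1) ^ ((Tuple.sort c)⁻¹ j : ℕ) * sgn (Tuple.sort c) * hsign
  calc d N n ∘ₗ adams N α (n + 1)
      = ∑ j : Fin n, ((-1 : ℂ) ^ (j : ℕ)) • face N n j ∘ₗ adams N α (n + 1) := by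
        ext; simp [d]
    _ = ∑ c : Fin n → α, sgn (Tuple.sort c) • permute N (Tuple.sort c) ∘ₗ d N n := by
        simp only [hface]
        rw [Finset.sum_comm]
        refine Finset.sum_congr rfl fun c _ => ?_
        rw [Equiv.sum_comp (Tuple.sort c)⁻¹ fun i : Fin n => sgn (Tuple.sort c) •
          (permute N (Tuple.sort c) ∘ₗ (((-1 : ℂ) ^ (i : ℕ)) • face N n i))]
        ext; simp [d, Finset.smul_sum]
    _ = adams N α n ∘ₗ d N n := by ext; simp [adams]

theorem d_comp_e (n k : ℕ) : d N n ∘ₗ e N (n + 1) k = e N n k ∘ₗ d N n := by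
  rcases lt_or_ge (n + 1) k with hk | hk
  · rw [e_eq_zero N hk, e_eq_zero N (n.lt_succ_self.trans hk), LinearMap.comp_zero,
      LinearMap.zero_comp]
  refine eq_of_sum_pow_smul (𝕜 := ℂ) (v := fun k => d N n ∘ₗ e N (n + 1) k)
    (w := fun k => e N n k ∘ₗ d N n) (fun M => ?_) (Nat.lt_succ_of_le hk)
  have hadams := d_comp_adams N (Fin M) n
  rw [← sum_pow_smul_e N M (n + 1).lt_succ_self,
    ← sum_pow_smul_e N M (n.lt_succ_self.trans (n + 1).lt_succ_self)] at hadams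
  ext a
  simpa using LinearMap.congr_fun hadams (tprod ℂ a)

end FacesAndPermutations

section LastFactor

variable {N : Type*} [NonUnitalCommRing N] [Module ℂ N]

/-- Splitting off the last factor of a chain. -/
def snocEquiv (n : ℕ) : ((⨂[ℂ]^n N) ⊗[ℂ] N) ≃ₗ[ℂ] (⨂[ℂ]^(n + 1) N) :=
  TensorProduct.congr (LinearEquiv.refl ℂ _)
    (PiTensorProduct.subsingletonEquiv (R := ℂ) (s := fun _ : Fin 1 => N) 0).symm ≪≫ₗ
    TensorPower.mulEquiv

theorem snocEquiv_tmul {n : ℕ} (c : ⨂[ℂ]^n N) (a : N) : snocEquiv n (c ⊗ₜ a) = snoc N c a := by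
  rw [snocEquiv, LinearEquiv.trans_apply, TensorProduct.congr_tmul, LinearEquiv.refl_apply, snoc,
    PiTensorProduct.subsingletonEquiv_symm_apply']

@[simp] theorem snocEquiv_symm_snoc {n : ℕ} (c : ⨂[ℂ]^n N) (a : N) :
    (snocEquiv n).symm (snoc N c a) = c ⊗ₜ a := by
  rw [← snocEquiv_tmul, LinearEquiv.symm_apply_apply]

theorem snoc_tprod {n : ℕ} (f : Fin n → N) (a : N) :
    snoc N (tprod ℂ f) a = tprod ℂ (Fin.snoc (α := fun _ => N) f a) := by
  have hmul := TensorPower.tprod_mul_tprod ℂ f (fun _ : Fin 1 => a)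
  rw [TensorPower.gMul_def] at hmul
  rw [snoc, hmul, Fin.append_right_eq_snoc]

theorem snoc_zero {n : ℕ} (a : N) : snoc N (0 : ⨂[ℂ]^n N) a = 0 := by
  simp only [← snocEquiv_tmul, TensorProduct.zero_tmul, map_zero]

theorem snoc_add {n : ℕ} (c c' : ⨂[ℂ]^n N) (a : N) :
    snoc N (c + c') a = snoc N c a + snoc N c' a := by
  simp only [← snocEquiv_tmul, TensorProduct.add_tmul, map_add]

theorem snoc_smul {n : ℕ} (r : ℂ) (c : ⨂[ℂ]^n N) (a : N) :
    snoc N (r • c) a = r • snoc N c a := by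
  simp only [← snocEquiv_tmul, ← TensorProduct.smul_tmul', map_smul]

theorem snoc_sum {n : ℕ} {ι : Type*} (s : Finset ι) (c : ι → ⨂[ℂ]^n N) (a : N) :
    snoc N (∑ i ∈ s, c i) a = ∑ i ∈ s, snoc N (c i) a := by
  simp only [← snocEquiv_tmul, TensorProduct.sum_tmul, map_sum]

theorem snoc_zero_right {n : ℕ} (c : ⨂[ℂ]^n N) : snoc N c 0 = 0 := by
  simp only [← snocEquiv_tmul, TensorProduct.tmul_zero, map_zero]

theorem snoc_neg_right {n : ℕ} (c : ⨂[ℂ]^n N) (a : N) : snoc N c (-a) = -snoc N c a := by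
  simp only [← snocEquiv_tmul, TensorProduct.tmul_neg, map_neg]

theorem snoc_add_right {n : ℕ} (c : ⨂[ℂ]^n N) (a b : N) :
    snoc N c (a + b) = snoc N c a + snoc N c b := by
  simp only [← snocEquiv_tmul, TensorProduct.tmul_add, map_add]

theorem snoc_smul_right {n : ℕ} (r : ℂ) (c : ⨂[ℂ]^n N) (a : N) :
    snoc N c (r • a) = r • snoc N c a := by
  simp only [← snocEquiv_tmul, TensorProduct.tmul_smul, map_smul]

theorem snoc_sum_right {n : ℕ} {ι : Type*} (s : Finset ι) (c : ⨂[ℂ]^n N) (a : ι → N) :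
    snoc N c (∑ i ∈ s, a i) = ∑ i ∈ s, snoc N c (a i) := by
  simp only [← snocEquiv_tmul, TensorProduct.tmul_sum, map_sum]

variable {V : Type*} [AddCommMonoid V] [Module ℂ V]

theorem ext_snoc {n : ℕ} {f g : (⨂[ℂ]^(n + 1) N) →ₗ[ℂ] V}
    (h : ∀ c a, f (snoc N c a) = g (snoc N c a)) : f = g := by
  have hcomp : f ∘ₗ (snocEquiv n).toLinearMap = g ∘ₗ (snocEquiv n).toLinearMap :=
    TensorProduct.ext' fun c a => by simpa [snocEquiv_tmul] using h c a
  refine LinearMap.ext fun z => ?_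
  obtain ⟨w, rfl⟩ := (snocEquiv n).surjective z
  exact LinearMap.congr_fun hcomp w

theorem ext_snoc_tmul {X : Type*} [AddCommMonoid X] [Module ℂ X] {n : ℕ}
    {f g : (⨂[ℂ]^(n + 1) N) ⊗[ℂ] X →ₗ[ℂ] V}
    (h : ∀ c a x, f (snoc N c a ⊗ₜ x) = g (snoc N c a ⊗ₜ x)) : f = g :=
  TensorProduct.ext (ext_snoc fun c a => LinearMap.ext (h c a))

theorem ext_snoc_snoc {n : ℕ} {f g : (⨂[ℂ]^(n + 2) N) →ₗ[ℂ] V}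
    (h : ∀ c a b, f (snoc N (snoc N c a) b) = g (snoc N (snoc N c a) b)) : f = g := by
  have hcomp : f ∘ₗ (snocEquiv (n + 1)).toLinearMap = g ∘ₗ (snocEquiv (n + 1)).toLinearMap :=
    ext_snoc_tmul fun c a b => by simpa [snocEquiv_tmul] using h c a b
  exact ext_snoc fun c a => by
    simpa [snocEquiv_tmul] using LinearMap.congr_fun hcomp (c ⊗ₜ a)

theorem ext_snoc_snoc_snoc {n : ℕ} {f g : (⨂[ℂ]^(n + 3) N) →ₗ[ℂ] V}
    (h : ∀ u a b c, f (snoc N (snoc N (snoc N u a) b) c) =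
      g (snoc N (snoc N (snoc N u a) b) c)) : f = g := by
  have hcomp : f ∘ₗ (snocEquiv (n + 2)).toLinearMap = g ∘ₗ (snocEquiv (n + 2)).toLinearMap :=
    TensorProduct.ext (ext_snoc_snoc fun u a b => LinearMap.ext fun c => by
      simpa [snocEquiv_tmul] using h u a b c)
  exact ext_snoc fun c a => by
    simpa [snocEquiv_tmul] using LinearMap.congr_fun hcomp (c ⊗ₜ a)

variable {X Y : Type*} [AddCommMonoid X] [Module ℂ X] [AddCommMonoid Y] [Module ℂ Y]

/-- The map `u ⊗ b ⊗ x ↦ u ⊗ f(b, x)` that merges the last factor of a chain into `x`. -/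
def mergeWith (f : N →ₗ[ℂ] X →ₗ[ℂ] Y) (n : ℕ) :
    (⨂[ℂ]^(n + 1) N) ⊗[ℂ] X →ₗ[ℂ] (⨂[ℂ]^n N) ⊗[ℂ] Y :=
  LinearMap.lTensor _ (TensorProduct.lift f) ∘ₗ (TensorProduct.assoc ℂ _ _ _).toLinearMap ∘ₗ
    LinearMap.rTensor X (snocEquiv n).symm.toLinearMap

theorem mergeWith_tmul (f : N →ₗ[ℂ] X →ₗ[ℂ] Y) {n : ℕ} (u : ⨂[ℂ]^n N) (b : N) (x : X) :
    mergeWith f n (snoc N u b ⊗ₜ x) = u ⊗ₜ f b x := by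
  simp [mergeWith]

end LastFactor

section BarDifferential

theorem contractNth_castSucc_snoc {A : Type*} (op : A → A → A) {n : ℕ} (j : Fin n)
    (f : Fin (n + 1) → A) (a : A) :
    Fin.contractNth j.castSucc.castSucc op (Fin.snoc (α := fun _ => A) f a) =
      Fin.snoc (α := fun _ => A) (Fin.contractNth j.castSucc op f) a := by
  funext p
  rw [contractNth_castSucc_apply]
  induction p using Fin.lastCases with
  | last =>
    rw [if_neg (Fin.castSucc_lt_last j).ne', Fin.snoc_last,
      Fin.succAbove_of_le_castSucc _ _ (by simp [Fin.le_def]), Fin.succ_last, Fin.snoc_last]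
  | cast p =>
    rw [Fin.snoc_castSucc, Fin.snoc_castSucc, contractNth_castSucc_apply, Fin.succ_castSucc,
      Fin.snoc_castSucc, Fin.castSucc_succAbove_castSucc, Fin.snoc_castSucc]
    simp only [Fin.castSucc_inj]

theorem contractNth_last_snoc_snoc {A : Type*} (op : A → A → A) {n : ℕ} (f : Fin n → A)
    (b a : A) :
    Fin.contractNth (Fin.last n).castSucc op
      (Fin.snoc (α := fun _ => A) (Fin.snoc (α := fun _ => A) f b) a) =
      Fin.snoc (α := fun _ => A) f (op b a) := by
  funext p
  rw [contractNth_castSucc_apply]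
  induction p using Fin.lastCases with
  | last => simp
  | cast p =>
    rw [if_neg (Fin.castSucc_lt_last p).ne, Fin.snoc_castSucc,
      Fin.succAbove_of_castSucc_lt _ _ (by simp [Fin.lt_def]), Fin.snoc_castSucc,
      Fin.snoc_castSucc]

variable {N : Type*} [NonUnitalCommRing N] [Module ℂ N] [IsScalarTower ℂ N N]
  [SMulCommClass ℂ N N]

theorem face_castSucc_snoc {n : ℕ} (j : Fin n) (c : ⨂[ℂ]^(n + 1) N) (a : N) :
    face N (n + 1) j.castSucc (snoc N c a) = snoc N (face N n j c) a := by
  induction c using PiTensorProduct.induction_on with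
  | smul_tprod r f =>
    simp only [snoc_smul, map_smul, snoc_tprod, face_tprod, contractNth_castSucc_snoc]
  | add x y hx hy => simp only [snoc_add, map_add, hx, hy]

theorem face_last_snoc_snoc {n : ℕ} (u : ⨂[ℂ]^n N) (b a : N) :
    face N (n + 1) (Fin.last n) (snoc N (snoc N u b) a) = snoc N u (b * a) := by
  induction u using PiTensorProduct.induction_on with
  | smul_tprod r f =>
    simp only [snoc_smul, map_smul, snoc_tprod, face_tprod, contractNth_last_snoc_snoc]
  | add x y hx hy => simp only [snoc_add, map_add, hx, hy]

theorem d_zero : d N 0 = 0 := by simp [d]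

theorem d_snoc_snoc {n : ℕ} (u : ⨂[ℂ]^n N) (b a : N) :
    d N (n + 1) (snoc N (snoc N u b) a) =
      snoc N (d N n (snoc N u b)) a + (-1 : ℂ) ^ n • snoc N u (b * a) := by
  simp only [d, Fin.sum_univ_castSucc, LinearMap.add_apply, LinearMap.sum_apply,
    LinearMap.smul_apply, face_castSucc_snoc, face_last_snoc_snoc, Fin.val_castSucc, Fin.val_last,
    snoc_sum, snoc_smul]

variable {X Y : Type*} [AddCommGroup X] [Module ℂ X] [AddCommGroup Y] [Module ℂ Y]

/-- The differential of the bar complex of `N` with coefficients in `X`, where `N` acts on `X` by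
`act`. -/
def bdry (act : N →ₗ[ℂ] X →ₗ[ℂ] X) (n : ℕ) :
    (⨂[ℂ]^(n + 1) N) ⊗[ℂ] X →ₗ[ℂ] (⨂[ℂ]^n N) ⊗[ℂ] X :=
  LinearMap.rTensor X (d N n) + (-1 : ℂ) ^ n • mergeWith act n

theorem bdry_apply_tmul (act : N →ₗ[ℂ] X →ₗ[ℂ] X) {n : ℕ} (z : ⨂[ℂ]^(n + 1) N) (x : X) :
    bdry act n (z ⊗ₜ x) = d N n z ⊗ₜ x + (-1 : ℂ) ^ n • mergeWith act n (z ⊗ₜ x) := rfl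

theorem bdry_snoc_tmul (act : N →ₗ[ℂ] X →ₗ[ℂ] X) {n : ℕ} (u : ⨂[ℂ]^n N) (b : N) (x : X) :
    bdry act n (snoc N u b ⊗ₜ x) = d N n (snoc N u b) ⊗ₜ x + (-1 : ℂ) ^ n • (u ⊗ₜ act b x) := by
  rw [bdry_apply_tmul, mergeWith_tmul]

theorem bdry_comp_lTensor {act : N →ₗ[ℂ] X →ₗ[ℂ] X} {act' : N →ₗ[ℂ] Y →ₗ[ℂ] Y} {f : X →ₗ[ℂ] Y}
    (hf : ∀ a x, f (act a x) = act' a (f x)) (n : ℕ) :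
    bdry act' n ∘ₗ LinearMap.lTensor _ f = LinearMap.lTensor _ f ∘ₗ bdry act n := by
  refine ext_snoc_tmul fun u b x => ?_
  simp only [LinearMap.comp_apply, LinearMap.lTensor_tmul, bdry_snoc_tmul, map_add, map_smul, hf]

theorem d_snocEquiv (n : ℕ) (z : (⨂[ℂ]^(n + 1) N) ⊗[ℂ] N) :
    d N (n + 1) (snocEquiv (n + 1) z) = snocEquiv n (bdry (LinearMap.mul ℂ N) n z) := by
  have hcomp : d N (n + 1) ∘ₗ (snocEquiv (n + 1)).toLinearMap =
      (snocEquiv n).toLinearMap ∘ₗ bdry (LinearMap.mul ℂ N) n :=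
    ext_snoc_tmul fun u b a => by
      simp only [LinearMap.comp_apply, LinearEquiv.coe_coe, snocEquiv_tmul, bdry_snoc_tmul,
        map_add, map_smul, d_snoc_snoc, LinearMap.mul_apply']
  exact LinearMap.congr_fun hcomp z

theorem bdry_bdry_snoc_snoc_tmul {act : N →ₗ[ℂ] X →ₗ[ℂ] X}
    (hact : ∀ a b x, act (a * b) x = act a (act b x)) {n : ℕ} (hd : d N n ∘ₗ d N (n + 1) = 0)
    (w : ⨂[ℂ]^n N) (c b : N) (x : X) :
    bdry act n (bdry act (n + 1) (snoc N (snoc N w c) b ⊗ₜ x)) = 0 := by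
  have hdd : d N n (d N (n + 1) (snoc N (snoc N w c) b)) = 0 := LinearMap.congr_fun hd _
  rw [bdry_snoc_tmul, map_add, map_smul, bdry_snoc_tmul, bdry_apply_tmul, hdd,
    TensorProduct.zero_tmul, zero_add, d_snoc_snoc, TensorProduct.add_tmul,
    ← TensorProduct.smul_tmul', map_add, map_smul, mergeWith_tmul, mergeWith_tmul, hact, pow_succ]
  module

theorem bdry_comp_bdry_of_d_comp_d {act : N →ₗ[ℂ] X →ₗ[ℂ] X}
    (hact : ∀ a b x, act (a * b) x = act a (act b x)) {n : ℕ} (hd : d N n ∘ₗ d N (n + 1) = 0) :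
    bdry act n ∘ₗ bdry act (n + 1) = 0 := by
  refine TensorProduct.ext (LinearMap.ext fun z => LinearMap.ext fun x => ?_)
  obtain ⟨v, rfl⟩ := (snocEquiv (n + 1)).surjective z
  have hzero : bdry act n ∘ₗ bdry act (n + 1) ∘ₗ (TensorProduct.mk ℂ _ X).flip x ∘ₗ
      (snocEquiv (n + 1)).toLinearMap = 0 :=
    ext_snoc_tmul fun w c b => by
      simpa [snocEquiv_tmul] using bdry_bdry_snoc_snoc_tmul hact hd w c b x
  exact LinearMap.congr_fun hzero v

theorem d_comp_d (n : ℕ) : d N n ∘ₗ d N (n + 1) = 0 := by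
  induction n with
  | zero => rw [d_zero, LinearMap.zero_comp]
  | succ n ih =>
    refine LinearMap.ext fun z => ?_
    obtain ⟨v, rfl⟩ := (snocEquiv (n + 2)).surjective z
    have hbdry : bdry (LinearMap.mul ℂ N) n ∘ₗ bdry (LinearMap.mul ℂ N) (n + 1) = 0 :=
      bdry_comp_bdry_of_d_comp_d (by simp [mul_assoc]) ih
    rw [LinearMap.comp_apply, d_snocEquiv, d_snocEquiv, ← LinearMap.comp_apply (bdry _ n), hbdry]
    simp

theorem bdry_comp_bdry {act : N →ₗ[ℂ] X →ₗ[ℂ] X}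
    (hact : ∀ a b x, act (a * b) x = act a (act b x)) (n : ℕ) :
    bdry act n ∘ₗ bdry act (n + 1) = 0 :=
  bdry_comp_bdry_of_d_comp_d hact (d_comp_d n)

end BarDifferential

section Resolution

variable {N : Type*} [NonUnitalCommRing N] [Module ℂ N] {A : Type*} [CommRing A] [Algebra ℂ A]

variable (N A) in
/-- A presentation of `N` as the augmentation ideal of a commutative algebra `A`. -/
structure Augmentation where
  /-- The inclusion of the augmentation ideal. -/
  incl : N →ₙₐ[ℂ] A
  /-- The augmentation. -/
  aug : A →ₐ[ℂ] ℂ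
  incl_injective : Function.Injective incl
  exact : Function.Exact incl aug

/-- The empty tensor, generating the space of `0`-chains. -/
abbrev emptyWord : ⨂[ℂ]^0 N := tprod ℂ Fin.elim0

theorem emptyWord_ne_zero : (emptyWord : ⨂[ℂ]^0 N) ≠ 0 := fun h => by
  simpa using congrArg (isEmptyEquiv (R := ℂ) (s := fun _ : Fin 0 => N) (Fin 0)) h

theorem exists_eq_smul_emptyWord (w : ⨂[ℂ]^0 N) : ∃ r : ℂ, w = r • emptyWord := by
  obtain ⟨r, rfl⟩ := (isEmptyEquiv (R := ℂ) (s := fun _ : Fin 0 => N) (Fin 0)).symm.surjective w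
  exact ⟨r, by rw [isEmptyEquiv, LinearEquiv.coe_symm_mk]; congr 2⟩

theorem exists_eq_emptyWord_tmul {X : Type*} [AddCommMonoid X] [Module ℂ X]
    (z : (⨂[ℂ]^0 N) ⊗[ℂ] X) : ∃ x, z = emptyWord ⊗ₜ x := by
  induction z using TensorProduct.induction_on with
  | zero => exact ⟨0, (TensorProduct.tmul_zero _ _).symm⟩
  | tmul w x =>
    obtain ⟨r, rfl⟩ := exists_eq_smul_emptyWord w
    exact ⟨r • x, TensorProduct.smul_tmul r _ x⟩
  | add z z' hz hz' =>
    obtain ⟨x, rfl⟩ := hz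
    obtain ⟨x', rfl⟩ := hz'
    exact ⟨x + x', (TensorProduct.tmul_add _ _ _).symm⟩

namespace Augmentation

variable (α : Augmentation N A)

theorem aug_incl (b : N) : α.aug (α.incl b) = 0 := α.exact.apply_apply_eq_zero b

theorem sub_aug_mem_range (a : A) :
    a - α.aug a • 1 ∈ LinearMap.range (α.incl : N →ₗ[ℂ] A) :=
  (α.exact _).1 (by simp)

/-- The projection `a ↦ a - aug a` onto the augmentation ideal. -/
def proj : A →ₗ[ℂ] N :=
  (LinearEquiv.ofInjective (α.incl : N →ₗ[ℂ] A) α.incl_injective).symm.toLinearMap ∘ₗ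
    LinearMap.codRestrict _ (LinearMap.id - α.aug.toLinearMap.smulRight (1 : A))
      α.sub_aug_mem_range

theorem incl_proj (a : A) : α.incl (α.proj a) = a - α.aug a • 1 :=
  congrArg Subtype.val ((LinearEquiv.ofInjective (α.incl : N →ₗ[ℂ] A)
    α.incl_injective).apply_symm_apply ⟨_, α.sub_aug_mem_range a⟩)

theorem proj_incl_mul (b : N) (a : A) : α.proj (α.incl b * a) = b * α.proj a + α.aug a • b :=
  α.incl_injective (by
    rw [incl_proj, map_add, map_mul, map_mul, map_smul, incl_proj, aug_incl, zero_mul, zero_smul,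
      sub_zero, mul_sub, mul_smul_comm, mul_one, sub_add_cancel])

section Action

variable (X : Type*) [AddCommGroup X] [Module ℂ X] [Module A X] [IsScalarTower ℂ A X]

/-- The action of the augmentation ideal on an `A`-module. -/
def act : N →ₗ[ℂ] X →ₗ[ℂ] X :=
  (Algebra.lsmul ℂ ℂ X).toLinearMap ∘ₗ (α.incl : N →ₗ[ℂ] A)

variable {X}

theorem act_apply (b : N) (x : X) : α.act X b x = α.incl b • x := rfl

theorem act_mul (a b : N) (x : X) : α.act X (a * b) x = α.act X a (α.act X b x) := by
  rw [act_apply, map_mul, mul_smul, act_apply, act_apply]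

end Action

section FreeModule

variable {ι : Type*} [Fintype ι]

variable (A) in
/-- Vectors of constants in a free module. -/
def ofConst : (ι → ℂ) →ₗ[ℂ] (ι → A) := (Algebra.linearMap ℂ A).compLeft ι

variable [DecidableEq ι]

theorem ofConst_eq_sum (l : ι → ℂ) : ofConst A l = ∑ i, l i • Pi.single i (1 : A) := by
  rw [← Finset.univ_sum_single (ofConst A l)]
  refine Finset.sum_congr rfl fun i _ => ?_
  rw [← Pi.single_smul', ← Algebra.algebraMap_eq_smul_one]
  rfl

theorem ofConst_add_sum_act (x : ι → A) :
    ofConst A (fun i => α.aug (x i)) +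
      ∑ i, α.act (ι → A) (α.proj (x i)) (Pi.single i 1) = x := by
  conv_rhs => rw [← Finset.univ_sum_single x]
  rw [ofConst_eq_sum, ← Finset.sum_add_distrib]
  refine Finset.sum_congr rfl fun i _ => ?_
  rw [act_apply, incl_proj, ← Pi.single_smul', ← Pi.single_smul', ← Pi.single_add, smul_eq_mul,
    mul_one, add_sub_cancel]

/-- The contracting homotopy `w ⊗ x ↦ ∑ᵢ w ⊗ (xᵢ - aug xᵢ) ⊗ eᵢ` of the bar complex with
coefficients in a free module. -/
def homotopy (n : ℕ) : (⨂[ℂ]^n N) ⊗[ℂ] (ι → A) →ₗ[ℂ] (⨂[ℂ]^(n + 1) N) ⊗[ℂ] (ι → A) :=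
  ∑ i : ι, (TensorProduct.mk ℂ _ _).flip (Pi.single i 1) ∘ₗ (snocEquiv n).toLinearMap ∘ₗ
    LinearMap.lTensor _ (α.proj ∘ₗ LinearMap.proj i)

theorem homotopy_tmul {n : ℕ} (w : ⨂[ℂ]^n N) (x : ι → A) :
    α.homotopy n (w ⊗ₜ x) = ∑ i : ι, snoc N w (α.proj (x i)) ⊗ₜ[ℂ] Pi.single i (1 : A) := by
  simp [homotopy, snocEquiv_tmul]

variable [IsScalarTower ℂ N N] [SMulCommClass ℂ N N]

theorem bdry_homotopy_tmul {n : ℕ} (w : ⨂[ℂ]^n N) (x : ι → A) :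
    bdry (α.act (ι → A)) n (α.homotopy n (w ⊗ₜ x)) =
      ∑ i, d N n (snoc N w (α.proj (x i))) ⊗ₜ Pi.single i (1 : A) +
        (-1 : ℂ) ^ n • (w ⊗ₜ x - w ⊗ₜ ofConst A (fun i => α.aug (x i))) := by
  have hx : x - ofConst A (fun i => α.aug (x i)) = _ :=
    sub_eq_of_eq_add' (α.ofConst_add_sum_act x).symm
  simp only [homotopy_tmul, map_sum, bdry_snoc_tmul]
  rw [Finset.sum_add_distrib, ← TensorProduct.tmul_sub, hx, TensorProduct.tmul_sum,
    Finset.smul_sum]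

theorem bdry_homotopy_zero (w : ⨂[ℂ]^0 N) (x : ι → A) :
    bdry (α.act (ι → A)) 0 (α.homotopy 0 (w ⊗ₜ x)) =
      w ⊗ₜ x - w ⊗ₜ ofConst A (fun i => α.aug (x i)) := by
  simp only [bdry_homotopy_tmul, d_zero, LinearMap.zero_apply, TensorProduct.zero_tmul,
    Finset.sum_const_zero, zero_add, pow_zero, one_smul]

theorem homotopy_bdry_snoc_tmul {n : ℕ} (w : ⨂[ℂ]^n N) (b : N) (x : ι → A) :
    α.homotopy n (bdry (α.act (ι → A)) n (snoc N w b ⊗ₜ x)) =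
      ∑ i, d N (n + 1) (snoc N (snoc N w b) (α.proj (x i))) ⊗ₜ Pi.single i (1 : A) +
        (-1 : ℂ) ^ n • (snoc N w b ⊗ₜ ofConst A (fun i => α.aug (x i))) := by
  rw [ofConst_eq_sum, TensorProduct.tmul_sum, Finset.smul_sum, ← Finset.sum_add_distrib,
    bdry_snoc_tmul, map_add, map_smul, homotopy_tmul, homotopy_tmul, Finset.smul_sum,
    ← Finset.sum_add_distrib]
  refine Finset.sum_congr rfl fun i _ => ?_
  rw [act_apply, Pi.smul_apply, smul_eq_mul, proj_incl_mul, d_snoc_snoc, snoc_add_right,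
    snoc_smul_right, TensorProduct.add_tmul, TensorProduct.add_tmul, TensorProduct.tmul_smul,
    smul_add, add_assoc, ← TensorProduct.smul_tmul', ← TensorProduct.smul_tmul']

theorem bdry_homotopy_sub_homotopy_bdry (n : ℕ) (z : (⨂[ℂ]^(n + 1) N) ⊗[ℂ] (ι → A)) :
    bdry (α.act (ι → A)) (n + 1) (α.homotopy (n + 1) z) -
      α.homotopy n (bdry (α.act (ι → A)) n z) = (-1 : ℂ) ^ (n + 1) • z := by
  have hcomp : bdry (α.act (ι → A)) (n + 1) ∘ₗ α.homotopy (n + 1) -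
      α.homotopy n ∘ₗ bdry (α.act (ι → A)) n = (-1 : ℂ) ^ (n + 1) • LinearMap.id :=
    ext_snoc_tmul fun w b x => by
      rw [LinearMap.sub_apply, LinearMap.comp_apply, LinearMap.comp_apply, bdry_homotopy_tmul,
        homotopy_bdry_snoc_tmul, LinearMap.smul_apply, LinearMap.id_apply, pow_succ]
      module
  exact LinearMap.congr_fun hcomp z

theorem bdry_smul_homotopy {n : ℕ} {z : (⨂[ℂ]^(n + 1) N) ⊗[ℂ] (ι → A)}
    (hz : bdry (α.act (ι → A)) n z = 0) :
    bdry (α.act (ι → A)) (n + 1) ((-1 : ℂ) ^ (n + 1) • α.homotopy (n + 1) z) = z := by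
  have hbdry := α.bdry_homotopy_sub_homotopy_bdry n z
  rw [hz, map_zero, sub_zero] at hbdry
  rw [map_smul, hbdry, smul_smul, ← mul_pow, neg_one_mul, neg_neg, one_pow, one_smul]

end FreeModule

theorem exists_eq_ofConst_add_bdry [IsScalarTower ℂ N N] [SMulCommClass ℂ N N] {ι : Type*}
    [Finite ι] (z : (⨂[ℂ]^0 N) ⊗[ℂ] (ι → A)) :
    ∃ l y, z = emptyWord ⊗ₜ ofConst A l + bdry (α.act (ι → A)) 0 y := by
  classical
  have := Fintype.ofFinite ι
  obtain ⟨x, rfl⟩ := exists_eq_emptyWord_tmul z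
  exact ⟨_, α.homotopy 0 (emptyWord ⊗ₜ x), by rw [bdry_homotopy_zero, add_sub_cancel]⟩

end Augmentation

/-- A minimal resolution `⋯ → A^ι → A^ι → A → ℂ` of the augmentation, with the same rank in all
positive degrees. -/
structure MinimalResolution (α : Augmentation N A) (ι : Type*) where
  /-- The differentials between the free modules `A^ι`. -/
  map : ℕ → (ι → A) →ₗ[A] (ι → A)
  /-- The differential onto the augmentation ideal. -/
  cover : (ι → A) →ₗ[A] A
  exact_map : ∀ s, Function.Exact (map (s + 1)) (map s)
  exact_cover : Function.Exact (map 0) cover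
  exact_aug : Function.Exact cover α.aug
  minimal : ∀ s x i, α.aug (map s x i) = 0

namespace MinimalResolution

open Augmentation

variable {α : Augmentation N A} {ι : Type*} (F : MinimalResolution α ι)

/-- The differential onto the augmentation ideal, with values in `N`. -/
def toIdeal : (ι → A) →ₗ[ℂ] N := α.proj ∘ₗ F.cover.restrictScalars ℂ

theorem incl_toIdeal (x : ι → A) : α.incl (F.toIdeal x) = F.cover x := by
  rw [toIdeal, LinearMap.comp_apply, incl_proj, LinearMap.restrictScalars_apply,
    F.exact_aug.apply_apply_eq_zero, zero_smul, sub_zero]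

theorem toIdeal_act (b : N) (x : ι → A) :
    F.toIdeal (α.act (ι → A) b x) = b * F.toIdeal x :=
  α.incl_injective (by rw [incl_toIdeal, map_mul, incl_toIdeal, act_apply, map_smul, smul_eq_mul])

theorem toIdeal_surjective : Function.Surjective F.toIdeal := fun b => by
  obtain ⟨x, hx⟩ := (F.exact_aug _).1 (α.aug_incl b)
  exact ⟨x, α.incl_injective (by rw [incl_toIdeal, hx])⟩

theorem exact_toIdeal : Function.Exact (F.map 0) F.toIdeal := fun x => by
  rw [← F.exact_cover x, ← F.incl_toIdeal, map_eq_zero_iff _ α.incl_injective]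

/-- The differentials of the resolution, applied to coefficients of chains. -/
def mapCoeff (m s : ℕ) : (⨂[ℂ]^m N) ⊗[ℂ] (ι → A) →ₗ[ℂ] (⨂[ℂ]^m N) ⊗[ℂ] (ι → A) :=
  LinearMap.lTensor _ ((F.map s).restrictScalars ℂ)

/-- The surjection `A^ι → N`, applied to coefficients of chains. -/
def coverCoeff (m : ℕ) : (⨂[ℂ]^m N) ⊗[ℂ] (ι → A) →ₗ[ℂ] (⨂[ℂ]^m N) ⊗[ℂ] N :=
  LinearMap.lTensor _ F.toIdeal

theorem exact_mapCoeff (m s : ℕ) : Function.Exact (F.mapCoeff m (s + 1)) (F.mapCoeff m s) :=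
  Module.Flat.lTensor_exact (⨂[ℂ]^m N) (f := (F.map (s + 1)).restrictScalars ℂ)
    (g := (F.map s).restrictScalars ℂ) (F.exact_map s)

theorem exact_coverCoeff (m : ℕ) : Function.Exact (F.mapCoeff m 0) (F.coverCoeff m) :=
  Module.Flat.lTensor_exact (⨂[ℂ]^m N) (f := (F.map 0).restrictScalars ℂ) F.exact_toIdeal

theorem coverCoeff_surjective (m : ℕ) : Function.Surjective (F.coverCoeff m) :=
  LinearMap.lTensor_surjective _ F.toIdeal_surjective

section Differential

variable [IsScalarTower ℂ N N] [SMulCommClass ℂ N N]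

theorem bdry_mapCoeff (m s : ℕ) (z : (⨂[ℂ]^(m + 1) N) ⊗[ℂ] (ι → A)) :
    bdry (α.act (ι → A)) m (F.mapCoeff (m + 1) s z) =
      F.mapCoeff m s (bdry (α.act (ι → A)) m z) :=
  LinearMap.congr_fun (bdry_comp_lTensor (act := α.act (ι → A)) (act' := α.act (ι → A))
    (f := (F.map s).restrictScalars ℂ) (fun b x => (F.map s).map_smul (α.incl b) x) m) z

theorem bdry_coverCoeff (m : ℕ) (z : (⨂[ℂ]^(m + 1) N) ⊗[ℂ] (ι → A)) :
    bdry (LinearMap.mul ℂ N) m (F.coverCoeff (m + 1) z) =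
      F.coverCoeff m (bdry (α.act (ι → A)) m z) :=
  LinearMap.congr_fun (bdry_comp_lTensor F.toIdeal_act m) z

theorem d_snocEquiv_coverCoeff (m : ℕ) (z : (⨂[ℂ]^(m + 1) N) ⊗[ℂ] (ι → A)) :
    d N (m + 1) (snocEquiv (m + 1) (F.coverCoeff (m + 1) z)) =
      snocEquiv m (F.coverCoeff m (bdry (α.act (ι → A)) m z)) := by
  rw [d_snocEquiv, bdry_coverCoeff]

end Differential

section Generators

variable [Fintype ι] [DecidableEq ι]

/-- Lifts of the constants in the resolution along the columns of the double complex formed by the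
bar complexes with coefficients in the resolution; their images under `coverCoeff` generate the
homology of `N`. -/
def gen : (m s : ℕ) → (ι → ℂ) →ₗ[ℂ] (⨂[ℂ]^m N) ⊗[ℂ] (ι → A)
  | 0, _ => TensorProduct.mk ℂ _ _ emptyWord ∘ₗ ofConst A
  | m + 1, s => (-1 : ℂ) ^ m • (α.homotopy m ∘ₗ F.mapCoeff m s ∘ₗ gen m (s + 1))

theorem gen_zero_apply (s : ℕ) (l : ι → ℂ) : F.gen 0 s l = emptyWord ⊗ₜ ofConst A l := rfl

theorem gen_succ_apply (m s : ℕ) (l : ι → ℂ) :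
    F.gen (m + 1) s l = (-1 : ℂ) ^ m • α.homotopy m (F.mapCoeff m s (F.gen m (s + 1) l)) := rfl

/-- The chains which represent the homology of `N`. -/
def genCycle (m : ℕ) : (ι → ℂ) →ₗ[ℂ] (⨂[ℂ]^(m + 1) N) :=
  (snocEquiv m).toLinearMap ∘ₗ F.coverCoeff m ∘ₗ F.gen m 0

theorem genCycle_apply (m : ℕ) (l : ι → ℂ) :
    F.genCycle m l = snocEquiv m (F.coverCoeff m (F.gen m 0 l)) := rfl

variable [IsScalarTower ℂ N N] [SMulCommClass ℂ N N]

theorem bdry_gen (m s : ℕ) (l : ι → ℂ) :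
    bdry (α.act (ι → A)) m (F.gen (m + 1) s l) = F.mapCoeff m s (F.gen m (s + 1) l) := by
  induction m generalizing s with
  | zero =>
    have hconst : (fun i => α.aug (F.map s (ofConst A l) i)) = 0 := funext (F.minimal s _)
    rw [gen_succ_apply, gen_zero_apply, mapCoeff, LinearMap.lTensor_tmul,
      LinearMap.restrictScalars_apply, pow_zero, one_smul, α.bdry_homotopy_zero, hconst, map_zero,
      TensorProduct.tmul_zero, sub_zero]
  | succ m ih =>
    refine α.bdry_smul_homotopy ?_
    rw [LinearMap.comp_apply, bdry_mapCoeff, ih, (F.exact_mapCoeff m s).apply_apply_eq_zero]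

theorem exists_eq_gen_add_of_bdry_eq {m s : ℕ} {u : (⨂[ℂ]^(m + 1) N) ⊗[ℂ] (ι → A)}
    {u' : (⨂[ℂ]^m N) ⊗[ℂ] (ι → A)} (h : bdry (α.act (ι → A)) m u = F.mapCoeff m s u') :
    ∃ l y y', u = F.gen (m + 1) s l + F.mapCoeff (m + 1) s y +
      bdry (α.act (ι → A)) (m + 1) y' := by
  suffices hcycle : ∃ l y, bdry (α.act (ι → A)) m
      (u - F.gen (m + 1) s l - F.mapCoeff (m + 1) s y) = 0 by
    obtain ⟨l, y, hy⟩ := hcycle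
    exact ⟨l, y, _, by rw [α.bdry_smul_homotopy hy]; abel⟩
  induction m generalizing s with
  | zero =>
    obtain ⟨l, y, rfl⟩ := α.exists_eq_ofConst_add_bdry u'
    refine ⟨l, y, ?_⟩
    rw [map_sub, map_sub, h, bdry_gen, bdry_mapCoeff, map_add, gen_zero_apply]
    abel
  | succ m ih =>
    have hu' : F.mapCoeff m s (bdry (α.act (ι → A)) m u') = 0 := by
      rw [← bdry_mapCoeff, ← h]
      exact LinearMap.congr_fun (bdry_comp_bdry α.act_mul m) u
    obtain ⟨u'', hu''⟩ := (F.exact_mapCoeff m s _).1 hu'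
    obtain ⟨l, y, hy⟩ := ih hu''.symm
    refine ⟨l, (-1 : ℂ) ^ (m + 1) • α.homotopy (m + 1)
      (u' - F.gen (m + 1) (s + 1) l - F.mapCoeff (m + 1) (s + 1) y), ?_⟩
    rw [map_sub, map_sub, h, bdry_gen, bdry_mapCoeff, α.bdry_smul_homotopy hy, map_sub, map_sub,
      (F.exact_mapCoeff (m + 1) s).apply_apply_eq_zero]
    abel

theorem genCycle_mem_cycles (m : ℕ) (l : ι → ℂ) : F.genCycle m l ∈ cycles N (m + 1) := by
  cases m with
  | zero => exact LinearMap.mem_ker.2 (by rw [d_zero, LinearMap.zero_apply])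
  | succ m =>
    rw [genCycle_apply, cycles, LinearMap.mem_ker, d_snocEquiv_coverCoeff, bdry_gen,
      (F.exact_coverCoeff m).apply_apply_eq_zero, map_zero]

theorem exists_coverCoeff_eq {m : ℕ} {u : (⨂[ℂ]^m N) ⊗[ℂ] (ι → A)}
    (hu : snocEquiv m (F.coverCoeff m u) ∈ cycles N (m + 1)) :
    ∃ l y, F.coverCoeff m u = F.coverCoeff m (F.gen m 0 l + bdry (α.act (ι → A)) m y) := by
  cases m with
  | zero =>
    obtain ⟨l, y, rfl⟩ := α.exists_eq_ofConst_add_bdry u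
    exact ⟨l, y, rfl⟩
  | succ m =>
    rw [cycles, LinearMap.mem_ker, d_snocEquiv_coverCoeff, LinearEquiv.map_eq_zero_iff] at hu
    obtain ⟨u', hu'⟩ := (F.exact_coverCoeff m _).1 hu
    obtain ⟨l, y, y', rfl⟩ := F.exists_eq_gen_add_of_bdry_eq hu'.symm
    refine ⟨l, y', ?_⟩
    rw [map_add, map_add, (F.exact_coverCoeff (m + 1)).apply_apply_eq_zero, map_add, add_zero]

theorem exists_sub_genCycle_mem_boundaries {m : ℕ} {z : ⨂[ℂ]^(m + 1) N}
    (hz : z ∈ cycles N (m + 1)) : ∃ l, z - F.genCycle m l ∈ boundaries N (m + 1) := by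
  obtain ⟨v, rfl⟩ := (snocEquiv m).surjective z
  obtain ⟨u, rfl⟩ := F.coverCoeff_surjective m v
  obtain ⟨l, y, hly⟩ := F.exists_coverCoeff_eq hz
  refine ⟨l, snocEquiv (m + 1) (F.coverCoeff (m + 1) y), ?_⟩
  rw [d_snocEquiv_coverCoeff, hly, genCycle_apply, ← map_sub, map_add, add_sub_cancel_left]

/-- The surjection from the constants onto the homology of `N`. -/
def constToHoch (m : ℕ) : (ι → ℂ) →ₗ[ℂ] Hoch N (m + 1) :=
  Submodule.mkQ _ ∘ₗ
    LinearMap.codRestrict (cycles N (m + 1)) (F.genCycle m) (F.genCycle_mem_cycles m)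

theorem constToHoch_surjective (m : ℕ) : Function.Surjective (F.constToHoch m) := fun q => by
  obtain ⟨⟨z, hz⟩, rfl⟩ := Submodule.Quotient.mk_surjective _ q
  obtain ⟨l, hl⟩ := F.exists_sub_genCycle_mem_boundaries hz
  exact ⟨l, Eq.symm ((Submodule.Quotient.eq _).2 hl)⟩

end Generators

variable [IsScalarTower ℂ N N] [SMulCommClass ℂ N N]

include F in
theorem finite_hoch [Finite ι] (m : ℕ) : Module.Finite ℂ (Hoch N (m + 1)) := by
  classical
  have := Fintype.ofFinite ι
  exact Module.Finite.of_surjective _ (F.constToHoch_surjective m)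

include F in
theorem finrank_hoch_le [Fintype ι] (m : ℕ) :
    Module.finrank ℂ (Hoch N (m + 1)) ≤ Fintype.card ι := by
  classical
  rw [← Module.finrank_fintype_fun_eq_card ℂ]
  exact LinearMap.finrank_le_finrank_of_surjective (F.constToHoch_surjective m)

end MinimalResolution

end Resolution

section Contraction

variable {N : Type*} [NonUnitalCommRing N] [Module ℂ N]

/-- Evaluation of a linear form on the last factor: `u ⊗ a ↦ δ(a) u`. -/
def evalLast (δ : N →ₗ[ℂ] ℂ) (n : ℕ) : (⨂[ℂ]^(n + 1) N) →ₗ[ℂ] (⨂[ℂ]^n N) :=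
  (TensorProduct.rid ℂ _).toLinearMap ∘ₗ LinearMap.lTensor _ δ ∘ₗ (snocEquiv n).symm.toLinearMap

@[simp] theorem evalLast_snoc (δ : N →ₗ[ℂ] ℂ) {n : ℕ} (u : ⨂[ℂ]^n N) (a : N) :
    evalLast δ n (snoc N u a) = δ a • u := by
  simp [evalLast]

/-- Contraction of the last two factors with a bilinear form: `u ⊗ a ⊗ b ↦ β(a, b) u`. -/
def contractLast (β : N →ₗ[ℂ] N →ₗ[ℂ] ℂ) (n : ℕ) : (⨂[ℂ]^(n + 2) N) →ₗ[ℂ] (⨂[ℂ]^n N) :=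
  (TensorProduct.rid ℂ _).toLinearMap ∘ₗ mergeWith β n ∘ₗ (snocEquiv (n + 1)).symm.toLinearMap

@[simp] theorem contractLast_snoc_snoc (β : N →ₗ[ℂ] N →ₗ[ℂ] ℂ) {n : ℕ} (u : ⨂[ℂ]^n N) (a b : N) :
    contractLast β n (snoc N (snoc N u a) b) = β a b • u := by
  simp [contractLast, mergeWith_tmul]

/-- Contraction of the factors in positions `i` and `i + 1` with a bilinear form. -/
def contract (β : N →ₗ[ℂ] N →ₗ[ℂ] ℂ) : (n : ℕ) → Fin (n + 1) →
    (⨂[ℂ]^(n + 2) N) →ₗ[ℂ] (⨂[ℂ]^n N)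
  | 0, _ => contractLast β 0
  | n + 1, i => Fin.lastCases (contractLast β (n + 1)) (fun i => (snocEquiv n).toLinearMap ∘ₗ
      LinearMap.rTensor N (contract β n i) ∘ₗ (snocEquiv (n + 2)).symm.toLinearMap) i

theorem contract_last (β : N →ₗ[ℂ] N →ₗ[ℂ] ℂ) (n : ℕ) :
    contract β n (Fin.last n) = contractLast β n := by
  cases n with
  | zero => rfl
  | succ n => rw [contract, Fin.lastCases_last]

theorem contract_castSucc_snoc (β : N →ₗ[ℂ] N →ₗ[ℂ] ℂ) {n : ℕ} (i : Fin (n + 1))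
    (c : ⨂[ℂ]^(n + 2) N) (a : N) :
    contract β (n + 1) i.castSucc (snoc N c a) = snoc N (contract β n i c) a := by
  rw [contract, Fin.lastCases_castSucc]
  simp [snocEquiv_tmul]

theorem contractLast_tprod (β : N →ₗ[ℂ] N →ₗ[ℂ] ℂ) {n : ℕ} (f : Fin (n + 2) → N) :
    contractLast β n (tprod ℂ f) = β (f (Fin.last n).castSucc) (f (Fin.last n).succ) •
      tprod ℂ fun p : Fin n => f ((Fin.last n).succ.succAbove ((Fin.last n).succAbove p)) := by
  conv_lhs => rw [← Fin.snoc_init_self f, ← Fin.snoc_init_self (Fin.init f)]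
  rw [← snoc_tprod, ← snoc_tprod, contractLast_snoc_snoc]
  simp [Fin.init_def]

theorem contract_tprod (β : N →ₗ[ℂ] N →ₗ[ℂ] ℂ) {n : ℕ} (i : Fin (n + 1)) (f : Fin (n + 2) → N) :
    contract β n i (tprod ℂ f) = β (f i.castSucc) (f i.succ) •
      tprod ℂ fun p : Fin n => f (i.succ.succAbove (i.succAbove p)) := by
  induction n with
  | zero => rw [Fin.fin_one_eq_zero i, ← Fin.last_zero, contract_last, contractLast_tprod]
  | succ n ih =>
    induction i using Fin.lastCases with
    | last => rw [contract_last, contractLast_tprod]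
    | cast i =>
      conv_lhs => rw [← Fin.snoc_init_self f, ← snoc_tprod, contract_castSucc_snoc, ih, snoc_smul,
        snoc_tprod]
      rw [Fin.succ_castSucc]
      congr 2
      funext p
      induction p using Fin.lastCases with
      | last =>
        rw [Fin.snoc_last, Fin.succAbove_of_le_castSucc i.castSucc _ (by simp [Fin.le_def]; omega),
          Fin.succ_last, Fin.succAbove_of_le_castSucc _ _ (by simp [Fin.le_def]; omega),
          Fin.succ_last]
      | cast p =>
        rw [Fin.snoc_castSucc, Fin.castSucc_succAbove_castSucc, Fin.castSucc_succAbove_castSucc]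
        rfl

theorem contractLast_comp_permute_swap_mul {β : N →ₗ[ℂ] N →ₗ[ℂ] ℂ} (hβ : ∀ a b, β a b = β b a)
    {n : ℕ} (s : Perm (Fin (n + 2))) :
    contractLast β n ∘ₗ permute N (swap (Fin.last n).castSucc (Fin.last n).succ * s) =
      contractLast β n ∘ₗ permute N s := by
  have hswap (a : Fin (n + 2) → N) :
      contractLast β n (tprod ℂ (a ∘ swap (Fin.last n).castSucc (Fin.last n).succ)) =
        contractLast β n (tprod ℂ a) := by
    simp only [contractLast_tprod, Function.comp_apply, swap_apply_left, swap_apply_right]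
    rw [hβ]
    congr 2
    funext p
    rw [swap_apply_of_ne_of_ne _ (Fin.succAbove_ne _ _)]
    rw [← Fin.succAbove_succ_self]
    exact Fin.succAbove_right_injective.ne (Fin.succAbove_ne _ _)
  ext a
  simp only [LinearMap.compMultilinearMap_apply, LinearMap.comp_apply, permute_tprod]
  exact hswap fun p => a (s⁻¹ p)

theorem contractLast_comp_permute_insertPerm (β : N →ₗ[ℂ] N →ₗ[ℂ] ℂ) {n : ℕ} (i : Fin (n + 1))
    (s : Perm (Fin n)) :
    contractLast β n ∘ₗ permute N (insertPerm i.succ (Fin.last n).succ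
      (insertPerm i (Fin.last n) s)) = permute N s ∘ₗ contract β n i := by
  have hcast {m : ℕ} (j : Fin m) : j.castSucc = j.succ.succAbove j :=
    (Fin.succAbove_succ_self j).symm
  have htprod (a : Fin (n + 2) → N) :
      contractLast β n (permute N (insertPerm i.succ (Fin.last n).succ
        (insertPerm i (Fin.last n) s)) (tprod ℂ a)) =
      permute N s (contract β n i (tprod ℂ a)) := by
    simp only [permute_tprod, contractLast_tprod, contract_tprod, map_smul, hcast,
      insertPerm_inv_self, insertPerm_inv_succAbove]
  ext a
  exact htprod a

theorem contractLast_comp_adams {β : N →ₗ[ℂ] N →ₗ[ℂ] ℂ} (hβ : ∀ a b, β a b = β b a)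
    (α : Type*) [LinearOrder α] [Fintype α] (n : ℕ) :
    contractLast β n ∘ₗ adams N α (n + 2) = ∑ c : Fin (n + 1) → α,
      sgn (Tuple.sort (c ∘ Fin.castSucc)) • (permute N (Tuple.sort (c ∘ Fin.castSucc)) ∘ₗ
        contract β n ((Tuple.sort c)⁻¹ (Fin.last n))) := by
  calc contractLast β n ∘ₗ adams N α (n + 2)
      = ∑ c : Fin (n + 2) → α, sgn (Tuple.sort c) •
          contractLast β n ∘ₗ permute N (Tuple.sort c) := by ext; simp [adams]
    _ = ∑ c : Fin (n + 1) → α,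
          ((-1) ^ (((Tuple.sort c)⁻¹ (Fin.last n) : ℕ) + (Fin.last n : Fin (n + 1))) *
            sgn (Tuple.sort c)) • contractLast β n ∘ₗ permute N
              (insertPerm ((Tuple.sort c)⁻¹ (Fin.last n)).succ (Fin.last n).succ
                (Tuple.sort c)) :=
        sum_sgn_sort (Fin.last n) (fun s => contractLast β n ∘ₗ permute N s)
          (contractLast_comp_permute_swap_mul hβ)
    _ = _ := Finset.sum_congr rfl fun c _ => ?_
  generalize hi : (Tuple.sort c)⁻¹ (Fin.last n) = i
  have hsort := sort_eq_insertPerm_last c (i := i) (by rw [← hi]; simp [Perm.inv_def])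
  have hsign : (-1 : ℂ) ^ ((i : ℕ) + (Fin.last n : Fin (n + 1))) *
      (-1) ^ ((i : ℕ) + (Fin.last n : Fin (n + 1))) = 1 := by rw [← mul_pow]; simp
  rw [hsort, contractLast_comp_permute_insertPerm, sgn_insertPerm, ← mul_assoc, hsign, one_mul]

variable [IsScalarTower ℂ N N] [SMulCommClass ℂ N N]

theorem contractLast_comp_d {β : N →ₗ[ℂ] N →ₗ[ℂ] ℂ} (hβ : ∀ a b c, β (a * b) c = β a (b * c))
    (n : ℕ) : contractLast β n ∘ₗ d N (n + 2) = d N n ∘ₗ contractLast β (n + 1) := by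
  refine ext_snoc_snoc_snoc fun u a b c => ?_
  simp only [LinearMap.comp_apply, contractLast_snoc_snoc, map_smul, d_snoc_snoc, map_add,
    snoc_add, snoc_smul, hβ, pow_succ]
  module

theorem evalLast_comp_d {δ : N →ₗ[ℂ] ℂ} (hδ : ∀ a b, δ (a * b) = 0) (n : ℕ) :
    evalLast δ n ∘ₗ d N (n + 1) = d N n ∘ₗ evalLast δ (n + 1) :=
  ext_snoc_snoc fun u a b => by simp [d_snoc_snoc, hδ]

theorem contractLast_mem_boundaries {β : N →ₗ[ℂ] N →ₗ[ℂ] ℂ}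
    (hβ : ∀ a b c, β (a * b) c = β a (b * c)) {n : ℕ} {z : ⨂[ℂ]^(n + 2) N}
    (hz : z ∈ boundaries N (n + 2)) : contractLast β n z ∈ boundaries N n := by
  obtain ⟨w, rfl⟩ := hz
  exact ⟨contractLast β (n + 1) w, (LinearMap.congr_fun (contractLast_comp_d hβ n) w).symm⟩

theorem evalLast_mem_boundaries {δ : N →ₗ[ℂ] ℂ} (hδ : ∀ a b, δ (a * b) = 0) {n : ℕ}
    {z : ⨂[ℂ]^(n + 1) N} (hz : z ∈ boundaries N (n + 1)) :
    evalLast δ n z ∈ boundaries N n := by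
  obtain ⟨w, rfl⟩ := hz
  exact ⟨evalLast δ (n + 1) w, (LinearMap.congr_fun (evalLast_comp_d hδ n) w).symm⟩

theorem boundaries_zero : boundaries N 0 = ⊥ := by
  rw [boundaries, d_zero, LinearMap.range_zero]

end Contraction

section Rows

variable {N : Type*} [NonUnitalCommRing N]

theorem M_add_two (x r : Fin 2 → N) (n : ℕ) : M N x r (n + 2) = M N x r n := by
  simp only [M, Nat.odd_add, even_two, iff_true]

variable [Module ℂ N]

/-- The rows `Pⁿ`, extended to degree zero by the row `P⁰ = (1, 0)`: then `P¹ = P⁰ ⊗ M₀`. -/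
def row (x r : Fin 2 → N) : (n : ℕ) → Fin 2 → ⨂[ℂ]^n N
  | 0 => ![emptyWord, 0]
  | n + 1 => fun j => ∑ i : Fin 2, snoc N (row x r n i) (M N x r n i j)

theorem row_succ (x r : Fin 2 → N) (n : ℕ) (j : Fin 2) :
    row x r (n + 1) j = ∑ i : Fin 2, snoc N (row x r n i) (M N x r n i j) := rfl

theorem row_one (x r : Fin 2 → N) (j : Fin 2) : row x r 1 j = snoc N emptyWord (x j) := by
  rw [row_succ, Fin.sum_univ_two]
  fin_cases j <;> simp [row, M, snoc_zero]

theorem row_add_two (x r : Fin 2 → N) (n : ℕ) (j : Fin 2) :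
    row x r (n + 2) j =
      ∑ i, ∑ k, snoc N (snoc N (row x r n i) (M N x r n i k)) (M N x r (n + 1) k j) := by
  simp only [row_succ x r (n + 1), row_succ x r n, snoc_sum]
  exact Finset.sum_comm

/-- The matrices `M_n` and `M_{n+1}` form a matrix factorization of `x₁r₁ + x₂r₂`, with respect to
any symmetric bilinear product. -/
theorem sum_bilin_M {V : Type*} [AddCommGroup V] [Module ℂ V] {β : N →ₗ[ℂ] N →ₗ[ℂ] V}
    (hβ : ∀ a b, β a b = β b a) (x r : Fin 2 → N) (n : ℕ) (i k : Fin 2) :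
    ∑ j, β (M N x r n i j) (M N x r (n + 1) j k) = if i = k then ∑ l, β (x l) (r l) else 0 := by
  rw [Fin.sum_univ_two, Fin.sum_univ_two]
  rcases Nat.even_or_odd n with hn | hn
  · have hn' : ¬Odd n := by simpa using hn
    fin_cases i <;> fin_cases k <;>
      simp [M, hn', hn.add_one, hβ (r 0), hβ (r 1) (x _), hβ (x 1) (x 0), add_comm]
  · have hn' : ¬Odd (n + 1) := by simpa using hn.add_one
    fin_cases i <;> fin_cases k <;>
      simp [M, hn, hn', hβ (r 0), hβ (r 1) (x _), add_comm]

theorem contractLast_row {β : N →ₗ[ℂ] N →ₗ[ℂ] ℂ} (hβ : ∀ a b, β a b = β b a) (x r : Fin 2 → N)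
    (n : ℕ) (j : Fin 2) :
    contractLast β n (row x r (n + 2) j) = (∑ i, β (x i) (r i)) • row x r n j := by
  simp only [row_add_two, map_sum, contractLast_snoc_snoc]
  simp only [← Finset.sum_smul, sum_bilin_M hβ, ite_smul, zero_smul, Finset.sum_ite_eq',
    Finset.mem_univ, if_true]

theorem contract_row {β : N →ₗ[ℂ] N →ₗ[ℂ] ℂ} (hβ : ∀ a b, β a b = β b a) (x r : Fin 2 → N)
    {n : ℕ} (i : Fin (n + 1)) (j : Fin 2) :
    contract β n i (row x r (n + 2) j) = (∑ i, β (x i) (r i)) • row x r n j := by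
  induction n generalizing j with
  | zero => rw [Fin.fin_one_eq_zero i, ← Fin.last_zero, contract_last, contractLast_row hβ]
  | succ n ih =>
    induction i using Fin.lastCases with
    | last => rw [contract_last, contractLast_row hβ]
    | cast i =>
      rw [row_succ, map_sum]
      simp only [contract_castSucc_snoc, ih, snoc_smul, M_add_two]
      rw [row_succ, Finset.smul_sum]

theorem contractLast_adams_row {β : N →ₗ[ℂ] N →ₗ[ℂ] ℂ} (hβ : ∀ a b, β a b = β b a)
    (x r : Fin 2 → N) (m n : ℕ) (j : Fin 2) :
    contractLast β n (adams N (Fin m) (n + 2) (row x r (n + 2) j)) =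
      (m * ∑ i, β (x i) (r i)) • adams N (Fin m) n (row x r n j) := by
  have hcomp (y : Fin m) (c : Fin n → Fin m) :
      (Fin.snocEquiv fun _ : Fin (n + 1) => Fin m) (y, c) ∘ Fin.castSucc = c := by
    funext p
    simp [Fin.snocEquiv]
  rw [← LinearMap.comp_apply, contractLast_comp_adams hβ]
  simp only [LinearMap.sum_apply, LinearMap.smul_apply, LinearMap.comp_apply, contract_row hβ,
    map_smul]
  rw [← (Fin.snocEquiv fun _ : Fin (n + 1) => Fin m).sum_comp, Fintype.sum_prod_type]
  simp only [hcomp, Finset.sum_const, Finset.card_univ, Fintype.card_fin, adams,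
    LinearMap.sum_apply, LinearMap.smul_apply, smul_comm _ (∑ i, β (x i) (r i)),
    ← Finset.smul_sum, mul_smul, Nat.cast_smul_eq_nsmul]

variable [IsScalarTower ℂ N N] [SMulCommClass ℂ N N]

theorem P_succ_eq_row (x r : Fin 2 → N) (n : ℕ) : P N x r (n + 1) = row x r (n + 1) := by
  induction n with
  | zero =>
    funext j
    rw [row_one, snoc_tprod, P]
    congr 1
  | succ n ih =>
    funext j
    rw [P, ih, row_succ]

theorem d_row {x r : Fin 2 → N} (hxr : ∑ i, x i * r i = 0) (n : ℕ) (j : Fin 2) :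
    d N n (row x r (n + 1) j) = 0 := by
  induction n generalizing j with
  | zero => simp [d_zero]
  | succ n ih =>
    have hM (i : Fin 2) : ∑ k, M N x r n i k * M N x r (n + 1) k j = 0 := by
      simpa [hxr] using sum_bilin_M (β := LinearMap.mul ℂ N) (fun a b => mul_comm a b) x r n i j
    have hdrow (k : Fin 2) : ∑ i, d N n (snoc N (row x r n i) (M N x r n i k)) = 0 := by
      rw [← map_sum, ← row_succ, ih]
    rw [row_add_two]
    simp only [map_sum, d_snoc_snoc, Finset.sum_add_distrib, ← Finset.smul_sum, ← snoc_sum_right,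
      hM, snoc_zero_right, smul_zero, add_zero]
    rw [Finset.sum_comm]
    simp only [← snoc_sum, hdrow, snoc_zero, Finset.sum_const_zero]

theorem row_mem_cycles {x r : Fin 2 → N} (hxr : ∑ i, x i * r i = 0) (n : ℕ) (j : Fin 2) :
    row x r n j ∈ cycles N n := by
  cases n with
  | zero => trivial
  | succ n => exact d_row hxr n j

end Rows

section Detector

variable {N : Type*} [NonUnitalCommRing N] [Module ℂ N]

/-- Cocycles of `N` which detect the classes of the rows `Pⁿ`: an invariant symmetric form that
pairs `x` with `r`, and the coordinate forms, which vanish on products. -/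
structure Detector (x r : Fin 2 → N) where
  rel : ∑ i, x i * r i = 0
  /-- The form which lowers the degree of a row by two. -/
  form : N →ₗ[ℂ] N →ₗ[ℂ] ℂ
  form_symm : ∀ a b, form a b = form b a
  form_mul : ∀ a b c, form (a * b) c = form a (b * c)
  form_rel : ∑ i, form (x i) (r i) = 1
  /-- The forms dual to `x`. -/
  lin : Fin 2 → N →ₗ[ℂ] ℂ
  lin_mul : ∀ i a b, lin i (a * b) = 0
  lin_coord : ∀ i j, lin i (x j) = if i = j then 1 else 0

namespace Detector

variable {x r : Fin 2 → N} (D : Detector x r)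

theorem contractLast_row (n : ℕ) (j : Fin 2) :
    contractLast D.form n (row x r (n + 2) j) = row x r n j := by
  rw [PlaneCurve.contractLast_row D.form_symm, D.form_rel, one_smul]

theorem contractLast_adams_row (m n : ℕ) (j : Fin 2) :
    contractLast D.form n (adams N (Fin m) (n + 2) (row x r (n + 2) j)) =
      (m : ℂ) • adams N (Fin m) n (row x r n j) := by
  rw [PlaneCurve.contractLast_adams_row D.form_symm, D.form_rel, mul_one]

variable [IsScalarTower ℂ N N] [SMulCommClass ℂ N N]

include D

theorem eq_zero_of_sum_row_one_mem {l : Fin 2 → ℂ}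
    (h : ∑ j, l j • row x r 1 j ∈ boundaries N 1) : l = 0 := by
  funext i
  have heval := evalLast_mem_boundaries (D.lin_mul i) h
  rw [boundaries_zero, Submodule.mem_bot] at heval
  simp only [row_one, map_sum, map_smul, evalLast_snoc, D.lin_coord] at heval
  simpa [emptyWord_ne_zero] using heval

theorem eq_zero_of_sum_row_two_mem {l : Fin 2 → ℂ}
    (h : ∑ j, l j • row x r 2 j ∈ boundaries N 2) : l = 0 := by
  have hcontract := contractLast_mem_boundaries D.form_mul h
  rw [boundaries_zero, Submodule.mem_bot] at hcontract
  have hl₀ : l 0 = 0 := by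
    simp only [map_sum, map_smul, D.contractLast_row] at hcontract
    simpa [row, emptyWord_ne_zero] using hcontract
  have heval : evalLast (D.lin 0) 1 (row x r 2 1) = row x r 1 1 := by
    rw [row_succ]
    simp [M, D.lin_coord]
  have hl₁ : ![0, l 1] = 0 := D.eq_zero_of_sum_row_one_mem <| by
    simpa [hl₀, heval] using evalLast_mem_boundaries (D.lin_mul 0) h
  funext i
  fin_cases i
  exacts [hl₀, congrFun hl₁ 1]

theorem eq_zero_of_sum_row_mem {n : ℕ} {l : Fin 2 → ℂ}
    (h : ∑ j, l j • row x r (n + 1) j ∈ boundaries N (n + 1)) : l = 0 := by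
  induction n using Nat.twoStepInduction with
  | zero => exact D.eq_zero_of_sum_row_one_mem h
  | one => exact D.eq_zero_of_sum_row_two_mem h
  | more n ih _ =>
    exact ih (by simpa only [map_sum, map_smul, D.contractLast_row] using
      contractLast_mem_boundaries D.form_mul h)

end Detector

end Detector

section Components

variable {N : Type*} [NonUnitalCommRing N] [Module ℂ N]

theorem e_apply_e {n : ℕ} (j k : ℕ) (z : ⨂[ℂ]^n N) :
    e N n j (e N n k z) = if j = k then e N n k z else 0 := by
  rw [← Module.End.mul_apply, e_mul_e]
  split_ifs <;> rfl

theorem mem_comp {n k : ℕ} {z : ⨂[ℂ]^n N} : z ∈ comp N n k ↔ e N n k z = z :=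
  ⟨by rintro ⟨w, rfl⟩; rw [e_apply_e, if_pos rfl], fun h => ⟨z, h⟩⟩

theorem e_sub_mem_of_adams {n p : ℕ} {W : Submodule ℂ (⨂[ℂ]^n N)} {v : ⨂[ℂ]^n N}
    (h : ∀ M : ℕ, adams N (Fin M) n v - (M : ℂ) ^ p • v ∈ W) (k : ℕ) :
    e N n k v - (if k = p then v else 0) ∈ W := by
  simp only [← Submodule.Quotient.eq] at h ⊢
  refine eq_of_sum_pow_smul (𝕜 := ℂ) (v := fun k => Submodule.Quotient.mk (p := W) (e N n k v))
    (w := fun k => Submodule.Quotient.mk (p := W) (if k = p then v else 0)) (K := n + p + k + 1)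
    (fun M => ?_) (by omega)
  have hsum := h M
  rw [← sum_pow_smul_e N M (K := n + p + k + 1) (by omega)] at hsum
  simp only [LinearMap.sum_apply, LinearMap.smul_apply, ← Submodule.mkQ_apply, map_sum,
    map_smul] at hsum ⊢
  rw [hsum, Finset.sum_eq_single_of_mem p (Finset.mem_range.2 (by omega))
    fun j _ hj => by rw [if_neg hj, map_zero, smul_zero], if_pos rfl]

variable [IsScalarTower ℂ N N] [SMulCommClass ℂ N N]

theorem d_e {n : ℕ} (k : ℕ) (z : ⨂[ℂ]^(n + 1) N) : d N n (e N (n + 1) k z) = e N n k (d N n z) :=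
  LinearMap.congr_fun (d_comp_e N n k) z

theorem e_mem_boundariesComp {n : ℕ} (k : ℕ) {z : ⨂[ℂ]^n N} (hz : z ∈ boundaries N n) :
    e N n k z ∈ boundariesComp N n k := by
  obtain ⟨w, rfl⟩ := hz
  exact ⟨_, ⟨w, rfl⟩, d_e k w⟩

theorem mem_cycles_of_commute {f : ∀ n, Module.End ℂ (⨂[ℂ]^n N)}
    (hf : ∀ n, d N n ∘ₗ f (n + 1) = f n ∘ₗ d N n) {n : ℕ} {z : ⨂[ℂ]^n N} (hz : z ∈ cycles N n) :
    f n z ∈ cycles N n := by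
  cases n with
  | zero => trivial
  | succ n =>
    have hdz : d N n z = 0 := hz
    change (d N n ∘ₗ f (n + 1)) z = 0
    rw [hf, LinearMap.comp_apply, hdz, map_zero]

theorem e_mem_cycles {n : ℕ} (k : ℕ) {z : ⨂[ℂ]^n N} (hz : z ∈ cycles N n) :
    e N n k z ∈ cycles N n :=
  mem_cycles_of_commute (f := fun n => e N n k) (fun n => d_comp_e N n k) hz

theorem adams_mem_cycles (M : ℕ) {n : ℕ} {z : ⨂[ℂ]^n N} (hz : z ∈ cycles N n) :
    adams N (Fin M) n z ∈ cycles N n :=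
  mem_cycles_of_commute (d_comp_adams N (Fin M)) hz

theorem e_mem_cyclesComp {n : ℕ} (k : ℕ) {z : ⨂[ℂ]^n N} (hz : z ∈ cycles N n) :
    e N n k z ∈ cyclesComp N n k :=
  ⟨e_mem_cycles k hz, ⟨z, rfl⟩⟩

variable (N) in
/-- The projection of `Hoch_n` to the component `H_{n,k}` induced by `e_n(k)`. -/
def toHComp (n k : ℕ) : Hoch N n →ₗ[ℂ] HComp N n k :=
  Submodule.mapQ _ _ ((e N n k).restrict fun _ hz => e_mem_cyclesComp k hz)
    fun _ hz => e_mem_boundariesComp k hz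

theorem toHoch_compClass {n k : ℕ} {z : ⨂[ℂ]^n N} (hz : z ∈ cyclesComp N n k) :
    toHoch N n k (compClass N n k z hz) = hochClass N n z hz.1 := rfl

theorem toHComp_toHoch {n k : ℕ} (q : HComp N n k) : toHComp N n k (toHoch N n k q) = q := by
  obtain ⟨⟨z, hz⟩, rfl⟩ := Submodule.Quotient.mk_surjective _ q
  exact congrArg Submodule.Quotient.mk
    (Subtype.ext (mem_comp.1 hz.2) : (⟨e N n k z, _⟩ : cyclesComp N n k) = ⟨z, hz⟩)

theorem toHComp_toHoch_of_ne {n j k : ℕ} (hjk : j ≠ k) (q : HComp N n k) :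
    toHComp N n j (toHoch N n k q) = 0 := by
  obtain ⟨⟨z, hz⟩, rfl⟩ := Submodule.Quotient.mk_surjective _ q
  have hez : e N n j z = 0 := by rw [← mem_comp.1 hz.2, e_apply_e, if_neg hjk]
  change compClass N n j (e N n j z) (e_mem_cyclesComp j hz.1) = 0
  simp only [hez]
  exact Submodule.Quotient.mk_zero _

theorem toHoch_injective (n k : ℕ) : Function.Injective (toHoch N n k) :=
  Function.LeftInverse.injective (toHComp_toHoch (N := N))

theorem disjoint_range_toHoch (n : ℕ) {j k : ℕ} (hjk : j ≠ k) :
    Disjoint (LinearMap.range (toHoch N n j)) (LinearMap.range (toHoch N n k)) := by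
  rw [Submodule.disjoint_def]
  rintro _ ⟨q, rfl⟩ ⟨q', hq'⟩
  rw [← toHComp_toHoch q, ← hq', toHComp_toHoch_of_ne hjk, map_zero]

section HochBasis

variable {n : ℕ} {ι : Type*} [Fintype ι] {v : ι → ⨂[ℂ]^n N} (hv : ∀ i, v i ∈ cycles N n)

theorem sum_smul_hochClass (g : ι → ℂ) :
    ∑ i, g i • hochClass N n (v i) (hv i) = hochClass N n (∑ i, g i • v i)
      (Submodule.sum_mem _ fun i _ => Submodule.smul_mem _ _ (hv i)) := by
  have hsum : (∑ i, g i • ⟨v i, hv i⟩ : cycles N n) = ⟨∑ i, g i • v i,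
      Submodule.sum_mem _ fun i _ => Submodule.smul_mem _ _ (hv i)⟩ := Subtype.ext (by simp)
  rw [hochClass, ← hsum, ← Submodule.mkQ_apply, map_sum]
  rfl

theorem hochClass_eq_iff {z w : ⨂[ℂ]^n N} {hz : z ∈ cycles N n} {hw : w ∈ cycles N n} :
    hochClass N n z hz = hochClass N n w hw ↔ z - w ∈ boundaries N n :=
  Submodule.Quotient.eq _

theorem exists_basis_hoch [Module.Finite ℂ (Hoch N n)]
    (hrank : Module.finrank ℂ (Hoch N n) ≤ Fintype.card ι)
    (hind : ∀ g : ι → ℂ, ∑ i, g i • v i ∈ boundaries N n → g = 0) :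
    ∃ b : Module.Basis ι ℂ (Hoch N n), ∀ i, b i = hochClass N n (v i) (hv i) := by
  have hli : LinearIndependent ℂ fun i => hochClass N n (v i) (hv i) := by
    refine Fintype.linearIndependent_iff.2 fun g hg => congrFun (hind g ?_)
    rw [sum_smul_hochClass] at hg
    simpa using (hochClass_eq_iff (hw := Submodule.zero_mem _)).1 hg
  exact ⟨basisOfLinearIndependentOfCardEqFinrank' _ hli
    (hli.fintype_card_le_finrank.antisymm hrank), fun i => by simp⟩

theorem exists_sub_sum_mem_boundaries {b : Module.Basis ι ℂ (Hoch N n)}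
    (hb : ∀ i, b i = hochClass N n (v i) (hv i)) {z : ⨂[ℂ]^n N} (hz : z ∈ cycles N n) :
    ∃ c : ι → ℂ, z - ∑ i, c i • v i ∈ boundaries N n := by
  have hrepr := b.sum_repr (hochClass N n z hz)
  simp only [hb, sum_smul_hochClass] at hrepr
  exact ⟨_, hochClass_eq_iff.1 hrepr.symm⟩

end HochBasis

section WeightBasis

variable {n : ℕ} {ι : Type*} {u : ι → ⨂[ℂ]^n N} (hu : ∀ i, u i ∈ cycles N n) {w : ι → ℕ}
  {b : Module.Basis ι ℂ (Hoch N n)}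
  (hb : ∀ i, b i = hochClass N n (e N n (w i) (u i)) (e_mem_cycles _ (hu i)))

include hu hb

theorem mem_range_toHoch (i : ι) : b i ∈ LinearMap.range (toHoch N n (w i)) :=
  ⟨compClass N n (w i) _ (e_mem_cyclesComp _ (hu i)), (hb i).symm⟩

theorem toHComp_basis_of_ne {k : ℕ} {i : ι} (hi : w i ≠ k) : toHComp N n k (b i) = 0 := by
  obtain ⟨q, hq⟩ := mem_range_toHoch hu hb i
  rw [← hq, toHComp_toHoch_of_ne hi.symm]

theorem toHComp_basis {k : ℕ} {i : ι} (hi : w i = k) :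
    toHComp N n k (b i) = compClass N n k (e N n k (u i)) (e_mem_cyclesComp k (hu i)) := by
  subst hi
  rw [hb, ← toHoch_compClass (e_mem_cyclesComp (w i) (hu i)), toHComp_toHoch]

theorem exists_basis_hComp {κ : Type*} {k : ℕ} {f : κ → ι} (hf : Function.Injective f)
    (hw : ∀ i, w i = k ↔ i ∈ Set.range f) :
    ∃ b' : Module.Basis κ ℂ (HComp N n k),
      ∀ j, b' j = compClass N n k (e N n k (u (f j))) (e_mem_cyclesComp k (hu (f j))) := by
  have hval (j : κ) : toHComp N n k (b (f j)) = compClass N n k (e N n k (u (f j)))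
      (e_mem_cyclesComp k (hu (f j))) := toHComp_basis hu hb ((hw _).2 ⟨j, rfl⟩)
  have hsection (j : κ) : toHoch N n k (toHComp N n k (b (f j))) = b (f j) := by
    obtain ⟨q, hq⟩ := (hw _).2 ⟨j, rfl⟩ ▸ mem_range_toHoch hu hb (f j)
    rw [← hq, toHComp_toHoch]
  have hli : LinearIndependent ℂ fun j => toHComp N n k (b (f j)) := by
    refine LinearIndependent.of_comp (toHoch N n k) ?_
    simpa only [Function.comp_def, hsection] using b.linearIndependent.comp f hf
  have hspan : ⊤ ≤ Submodule.span ℂ (Set.range fun j => toHComp N n k (b (f j))) := by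
    rw [← LinearMap.range_eq_top.2 (Function.LeftInverse.surjective (toHComp_toHoch (N := N))),
      LinearMap.range_eq_map, ← b.span_eq, Submodule.map_span_le]
    rintro _ ⟨i, rfl⟩
    by_cases hi : w i = k
    · obtain ⟨j, rfl⟩ := (hw i).1 hi
      exact Submodule.subset_span ⟨j, rfl⟩
    · rw [toHComp_basis_of_ne hu hb hi]
      exact Submodule.zero_mem _
  exact ⟨Module.Basis.mk hli hspan, fun j => by rw [Module.Basis.mk_apply, hval]⟩

theorem subsingleton_hComp {k : ℕ} (hw : ∀ i, w i ≠ k) : Subsingleton (HComp N n k) := by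
  obtain ⟨b', -⟩ := exists_basis_hComp hu hb (k := k) (f := Empty.elim)
    (fun x => x.elim) (fun i => by simp [hw])
  exact b'.repr.injective.subsingleton

theorem toHoch_bijective {k : ℕ} (hw : ∀ i, w i = k) : Function.Bijective (toHoch N n k) := by
  refine ⟨toHoch_injective n k, LinearMap.range_eq_top.1 (top_le_iff.1 ?_)⟩
  rw [← b.span_eq, Submodule.span_le]
  rintro _ ⟨i, rfl⟩
  exact hw i ▸ mem_range_toHoch hu hb i

theorem isCompl_range_toHoch {j k : ℕ} (hjk : j ≠ k) (hw : ∀ i, w i = j ∨ w i = k) :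
    IsCompl (LinearMap.range (toHoch N n j)) (LinearMap.range (toHoch N n k)) := by
  refine ⟨disjoint_range_toHoch n hjk, codisjoint_iff_le_sup.2 ?_⟩
  rw [← b.span_eq, Submodule.span_le]
  rintro _ ⟨i, rfl⟩
  rcases hw i with hi | hi
  · exact Submodule.mem_sup_left (hi ▸ mem_range_toHoch hu hb i)
  · exact Submodule.mem_sup_right (hi ▸ mem_range_toHoch hu hb i)

end WeightBasis

end Components

section AdamsEigenvectors

variable {N : Type*} [NonUnitalCommRing N] [Module ℂ N] (α : Type*) [LinearOrder α] [Fintype α]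

theorem adams_of_permute_eq_sgn_smul {n : ℕ} {z : ⨂[ℂ]^n N}
    (hz : ∀ s, permute N s z = sgn s • z) : adams N α n z = (Fintype.card α : ℂ) ^ n • z := by
  simp only [adams, LinearMap.sum_apply, LinearMap.smul_apply, hz, smul_smul, sgn_mul_self,
    one_smul, Finset.sum_const, Finset.card_univ, Fintype.card_fun, Fintype.card_fin,
    ← Nat.cast_smul_eq_nsmul ℂ, Nat.cast_pow]

theorem adams_of_le_one {n : ℕ} (hn : n ≤ 1) (z : ⨂[ℂ]^n N) :
    adams N α n z = (Fintype.card α : ℂ) ^ n • z := by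
  have : Subsingleton (Fin n) := Fin.subsingleton_iff_le_one.2 hn
  refine adams_of_permute_eq_sgn_smul α fun s => ?_
  rw [Subsingleton.elim s 1, map_one, map_one, one_smul, Module.End.one_apply]

theorem row_two_one (x r : Fin 2 → N) :
    row x r 2 1 = tprod ℂ ![x 1, x 0] - tprod ℂ ![x 0, x 1] := by
  have hpair (a b : N) : snoc N (snoc N emptyWord a) b = tprod ℂ ![a, b] := by
    rw [snoc_tprod, snoc_tprod]
    congr 1
    funext p
    fin_cases p <;> rfl
  rw [row_succ, Fin.sum_univ_two, row_one, row_one, ← hpair, ← hpair, sub_eq_neg_add,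
    ← snoc_neg_right]
  simp [M]

theorem permute_row_two_one (x r : Fin 2 → N) (s : Perm (Fin 2)) :
    permute N s (row x r 2 1) = sgn s • row x r 2 1 := by
  have hcases : ∀ s : Perm (Fin 2), s = 1 ∨ s = swap 0 1 := by decide
  have hswap (a b : N) : permute N (swap (0 : Fin 2) 1) (tprod ℂ ![a, b]) = tprod ℂ ![b, a] := by
    rw [permute_tprod]
    congr 1
    funext p
    fin_cases p <;> simp
  rcases hcases s with rfl | rfl
  · simp
  · rw [row_two_one, map_sub, hswap, hswap]
    simp [sgn_apply]

end AdamsEigenvectors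

section RowClasses

variable {N : Type*} [NonUnitalCommRing N] [Module ℂ N]

/-- The weights of the classes of the row `Pⁿ`: `(k, k + 1)` for `n = 2k` and `(k, k)` for
`n = 2k - 1`. -/
def weight (n : ℕ) : Fin 2 → ℕ := ![(n + 1) / 2, n / 2 + 1]

theorem weight_add_two (n : ℕ) (i : Fin 2) : weight (n + 2) i = weight n i + 1 := by
  fin_cases i <;> simp [weight]; omega

/-- The defect of `Pⁿ_j` from being an eigenvector of the `m`-th Adams operation. -/
def defect (x r : Fin 2 → N) (m n : ℕ) (j : Fin 2) : ⨂[ℂ]^n N :=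
  adams N (Fin m) n (row x r n j) - (m : ℂ) ^ weight n j • row x r n j

namespace Detector

variable {x r : Fin 2 → N} (D : Detector x r)

theorem contractLast_defect (m n : ℕ) (j : Fin 2) :
    contractLast D.form n (defect x r m (n + 2) j) = (m : ℂ) • defect x r m n j := by
  rw [defect, map_sub, map_smul, D.contractLast_adams_row, D.contractLast_row, weight_add_two,
    pow_succ', defect, smul_sub, smul_smul]

variable [IsScalarTower ℂ N N] [SMulCommClass ℂ N N]

theorem defect_mem_cycles (hxr : ∑ i, x i * r i = 0) (m n : ℕ) (j : Fin 2) :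
    defect x r m n j ∈ cycles N n :=
  Submodule.sub_mem _ (adams_mem_cycles m (row_mem_cycles hxr n j))
    (Submodule.smul_mem _ _ (row_mem_cycles hxr n j))

variable [∀ n, Module.Finite ℂ (Hoch N (n + 1))]
  (hrank : ∀ n, Module.finrank ℂ (Hoch N (n + 1)) ≤ 2)

include D hrank

theorem exists_basis_hoch_row (n : ℕ) :
    ∃ b : Module.Basis (Fin 2) ℂ (Hoch N (n + 1)),
      ∀ i, b i = hochClass N (n + 1) (row x r (n + 1) i) (row_mem_cycles D.rel (n + 1) i) :=
  exists_basis_hoch _ (by simpa using hrank n) fun _ => D.eq_zero_of_sum_row_mem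

theorem exists_sub_sum_row_mem {n : ℕ} {z : ⨂[ℂ]^(n + 1) N} (hz : z ∈ cycles N (n + 1)) :
    ∃ c : Fin 2 → ℂ, z - ∑ i, c i • row x r (n + 1) i ∈ boundaries N (n + 1) :=
  exists_sub_sum_mem_boundaries _ (D.exists_basis_hoch_row hrank n).choose_spec hz

theorem mem_boundaries_of_contractLast {n : ℕ} {z : ⨂[ℂ]^(n + 3) N} (hz : z ∈ cycles N (n + 3))
    (h : contractLast D.form (n + 1) z ∈ boundaries N (n + 1)) : z ∈ boundaries N (n + 3) := by
  obtain ⟨c, hc⟩ := D.exists_sub_sum_row_mem hrank hz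
  have hcontract := contractLast_mem_boundaries D.form_mul hc
  simp only [map_sub, map_sum, map_smul, D.contractLast_row] at hcontract
  have hc₀ : c = 0 := D.eq_zero_of_sum_row_mem ((Submodule.sub_mem_iff_right _ h).1 hcontract)
  simpa [hc₀] using hc

theorem defect_one_mem_boundaries (m n : ℕ) : defect x r m (n + 1) 1 ∈ boundaries N (n + 1) := by
  induction n using Nat.twoStepInduction with
  | zero => simp [defect, weight, adams_of_le_one]
  | one => simp [defect, weight, adams_of_permute_eq_sgn_smul _ (permute_row_two_one x r)]
  | more n ih _ =>
    refine D.mem_boundaries_of_contractLast hrank (defect_mem_cycles D.rel _ _ _) ?_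
    rw [D.contractLast_defect]
    exact Submodule.smul_mem _ _ ih

omit hrank [∀ n, Module.Finite ℂ (Hoch N (n + 1))] in
theorem eq_zero_of_smul_row_zero_mem {n : ℕ} {c : ℂ}
    (h : c • row x r n 0 ∈ boundaries N n ⊔ Submodule.span ℂ {row x r n 1}) : c = 0 := by
  cases n with
  | zero => simpa [boundaries_zero, row, emptyWord_ne_zero] using h
  | succ n =>
    obtain ⟨b, hb, v, hv, hsum⟩ := Submodule.mem_sup.1 h
    obtain ⟨a, rfl⟩ := Submodule.mem_span_singleton.1 hv
    have hl : ![c, -a] = 0 := D.eq_zero_of_sum_row_mem (n := n) <| by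
      simpa [← hsum] using hb
    exact congrFun hl 0

theorem mem_sup_span_row_of_contractLast {n : ℕ} {z : ⨂[ℂ]^(n + 2) N}
    (hz : z ∈ cycles N (n + 2))
    (h : contractLast D.form n z ∈ boundaries N n ⊔ Submodule.span ℂ {row x r n 1}) :
    z ∈ boundaries N (n + 2) ⊔ Submodule.span ℂ {row x r (n + 2) 1} := by
  obtain ⟨c, hc⟩ := D.exists_sub_sum_row_mem hrank hz
  have hcontract := contractLast_mem_boundaries D.form_mul hc
  simp only [map_sub, map_sum, map_smul, D.contractLast_row] at hcontract
  rw [Fin.sum_univ_two] at hcontract hc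
  have hspan (m : ℕ) (a : ℂ) :
      a • row x r m 1 ∈ boundaries N m ⊔ Submodule.span ℂ {row x r m 1} :=
    Submodule.mem_sup_right (Submodule.mem_span_singleton.2 ⟨a, rfl⟩)
  have hc₀ : c 0 = 0 := D.eq_zero_of_smul_row_zero_mem <| by
    simpa using Submodule.sub_mem _ (Submodule.sub_mem _ h (hspan n (c 1)))
      (Submodule.mem_sup_left hcontract)
  simpa [hc₀] using Submodule.add_mem _ (Submodule.mem_sup_left hc) (hspan (n + 2) (c 1))

theorem defect_zero_mem_sup (m n : ℕ) :
    defect x r m n 0 ∈ boundaries N n ⊔ Submodule.span ℂ {row x r n 1} := by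
  induction n using Nat.twoStepInduction with
  | zero => simp [defect, weight, adams_of_le_one]
  | one => simp [defect, weight, adams_of_le_one]
  | more n ih _ =>
    refine D.mem_sup_span_row_of_contractLast hrank (defect_mem_cycles D.rel _ _ _) ?_
    rw [D.contractLast_defect]
    exact Submodule.smul_mem _ _ ih

theorem eq_zero_of_sum_e_row_mem {n : ℕ} {g : Fin 2 → ℂ}
    (h : ∑ i, g i • e N (n + 1) (weight (n + 1) i) (row x r (n + 1) i) ∈ boundaries N (n + 1)) :
    g = 0 := by
  have hfst := e_sub_mem_of_adams (fun m => D.defect_zero_mem_sup hrank m (n + 1))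
    (weight (n + 1) 0)
  have hsnd := e_sub_mem_of_adams (fun m => D.defect_one_mem_boundaries hrank m n)
    (weight (n + 1) 1)
  rw [if_pos rfl] at hfst hsnd
  obtain ⟨b, hb, v, hv, hsum⟩ := Submodule.mem_sup.1 hfst
  obtain ⟨c, rfl⟩ := Submodule.mem_span_singleton.1 hv
  rw [Fin.sum_univ_two] at h
  have hl : ![g 0, g 0 * c + g 1] = 0 := D.eq_zero_of_sum_row_mem (n := n) <| by
    convert Submodule.sub_mem _ (Submodule.sub_mem _ h (Submodule.smul_mem _ (g 0) hb))
      (Submodule.smul_mem _ (g 1) hsnd) using 1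
    rw [Fin.sum_univ_two, eq_sub_of_add_eq hsum]
    simp only [Matrix.cons_val_zero, Matrix.cons_val_one]
    module
  have hg₀ : g 0 = 0 := congrFun hl 0
  have hg₁ : g 0 * c + g 1 = 0 := congrFun hl 1
  funext i
  fin_cases i
  exacts [hg₀, by simpa [hg₀] using hg₁]

theorem exists_basis_hoch_e_row (n : ℕ) :
    ∃ b : Module.Basis (Fin 2) ℂ (Hoch N (n + 1)),
      ∀ i, b i = hochClass N (n + 1) (e N (n + 1) (weight (n + 1) i) (row x r (n + 1) i))
        (e_mem_cycles _ (row_mem_cycles D.rel (n + 1) i)) :=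
  exists_basis_hoch _ (by simpa using hrank n) fun _ => D.eq_zero_of_sum_e_row_mem hrank

end Detector

end RowClasses

section MatrixFactorization

/-- Exactness of matrix factorizations (Eisenbud). -/
theorem exact_mulVecLin_of_mul_eq_smul_one {S ι : Type*} [CommRing S] [Fintype ι] [DecidableEq ι]
    {R : S} (hR : IsLeftRegular R) {Φ Ψ : Matrix ι ι S} (h : Φ * Ψ = R • 1) (h' : Ψ * Φ = R • 1) :
    Function.Exact (Ψ.map (Ideal.Quotient.mk (Ideal.span {R}))).mulVecLin
      (Φ.map (Ideal.Quotient.mk (Ideal.span {R}))).mulVecLin := by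
  set π := Ideal.Quotient.mk (Ideal.span {R})
  have lift : ∀ y : ι → S ⧸ Ideal.span {R}, ∃ v, π ∘ v = y :=
    fun y => ⟨_, funext fun i => (Ideal.Quotient.mk_surjective (y i)).choose_spec⟩
  have mulVec_map : ∀ (Θ : Matrix ι ι S) v, (Θ.map π).mulVecLin (π ∘ v) = π ∘ Θ.mulVec v :=
    fun Θ v => funext fun i => (π.map_mulVec Θ v i).symm
  have comp_eq_zero : ∀ v : ι → S, π ∘ v = 0 ↔ ∃ u, v = R • u := fun v => by
    simp only [funext_iff, Function.comp_apply, Pi.zero_apply, Pi.smul_apply, smul_eq_mul,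
      Ideal.Quotient.eq_zero_iff_mem, Ideal.mem_span_singleton, π, Dvd.dvd, Classical.skolem]
  intro y
  obtain ⟨v, rfl⟩ := lift y
  rw [mulVec_map, comp_eq_zero]
  constructor
  · rintro ⟨u, hu⟩
    have hv : R • v = R • Ψ.mulVec u := by
      rw [← Matrix.mulVec_smul, ← hu, Matrix.mulVec_mulVec, h', Matrix.smul_mulVec,
        Matrix.one_mulVec]
    exact ⟨π ∘ u, by rw [mulVec_map, funext fun i => hR (congrFun hv i)]⟩
  · rintro ⟨w, hw⟩
    have hΦΨ : Φ.map π * Ψ.map π = 0 := by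
      have hπ : π R = 0 := Ideal.Quotient.eq_zero_iff_mem.2 (Ideal.mem_span_singleton_self R)
      rw [← Matrix.map_mul, h]
      ext i j
      simp [hπ]
    rw [← comp_eq_zero, ← mulVec_map, ← hw, Matrix.mulVecLin_apply, Matrix.mulVecLin_apply,
      Matrix.mulVec_mulVec, hΦΨ, Matrix.zero_mulVec]

end MatrixFactorization

section CurveAlgebra

open MvPolynomial

theorem mem_maxIdeal {f : MvPolynomial (Fin 2) ℂ} : f ∈ maxIdeal ↔ constantCoeff f = 0 := by
  have hvars : maxIdeal = idealOfVars (Fin 2) ℂ := by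
    rw [maxIdeal, idealOfVars]
    congr 1
    ext
    simp [Fin.exists_fin_two, eq_comm]
  rw [hvars, ← pow_one (idealOfVars _ _), mem_pow_idealOfVars_iff']
  simp [constantCoeff_eq, Finsupp.degree_eq_zero_iff]

theorem coeff_single_one_mul {σ K : Type*} [CommSemiring K] (f g : MvPolynomial σ K) (i : σ) :
    coeff (Finsupp.single i 1) (f * g) = constantCoeff f * coeff (Finsupp.single i 1) g +
      constantCoeff g * coeff (Finsupp.single i 1) f := by
  have h : ∀ p : MvPolynomial σ K, coeff (Finsupp.single i 1) p = constantCoeff (pderiv i p) :=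
    fun p => by simp [constantCoeff_eq, coeff_pderiv]
  simp [h]

theorem exists_eq_mul_of_X_mul_add_X_mul_eq_zero {σ K : Type*} [CommRing K] [IsDomain K] {i j : σ}
    (hij : i ≠ j) {f g : MvPolynomial σ K} (h : X i * f + X j * g = 0) :
    ∃ u, f = -X j * u ∧ g = X i * u := by
  have hdvd : X i ∣ g := by
    refine (X_prime.dvd_or_dvd (a := X j) ⟨-f, ?_⟩).resolve_left (by simpa [X_dvd_X] using hij)
    linear_combination h
  obtain ⟨u, rfl⟩ := hdvd
  refine ⟨u, mul_left_cancel₀ (X_ne_zero i) ?_, rfl⟩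
  linear_combination h

theorem exists_linearMap_mul_left {σ K : Type*} [Field K] {R : MvPolynomial σ K} (hR : R ≠ 0) :
    ∃ L : MvPolynomial σ K →ₗ[K] K, ∀ f, L (R * f) = constantCoeff f := by
  obtain ⟨g, hg⟩ := (LinearMap.mulLeft K R).exists_leftInverse_of_injective
    (LinearMap.ker_eq_bot.2 fun _ _ h => mul_left_cancel₀ hR h)
  refine ⟨lcoeff K 0 ∘ₗ g, fun f => ?_⟩
  have hg' : g (R * f) = f := LinearMap.congr_fun hg f
  rw [LinearMap.comp_apply, hg', lcoeff_apply, constantCoeff_eq]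

variable {R : MvPolynomial (Fin 2) ℂ}

theorem exists_partials (hconst : constantCoeff R = 0)
    (hlin : ∀ i : Fin 2, coeff (Finsupp.single i 1) R = 0) :
    ∃ S : Fin 2 → maxIdeal, ∑ i, X i * (S i : MvPolynomial (Fin 2) ℂ) = R := by
  obtain ⟨a, b, rfl⟩ := Ideal.mem_span_pair.1 (mem_maxIdeal.2 hconst)
  have ha := hlin 0
  have hb := hlin 1
  simp only [coeff_add, coeff_single_one_mul] at ha hb
  refine ⟨![⟨a, mem_maxIdeal.2 ?_⟩, ⟨b, mem_maxIdeal.2 ?_⟩], ?_⟩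
  · simpa [coeff_X, Finsupp.single_left_inj] using ha
  · simpa [coeff_X, Finsupp.single_left_inj] using hb
  · simp [mul_comm]

theorem mk_eq_zero_iff {f : MvPolynomial (Fin 2) ℂ} :
    Ideal.Quotient.mk (Ideal.span {R}) f = 0 ↔ ∃ w, f = R * w := by
  rw [Ideal.Quotient.eq_zero_iff_mem, Ideal.mem_span_singleton, dvd_def]

variable (R) in
/-- The evaluation at the origin of functions on the curve `R = 0`. -/
def curveAug (hconst : constantCoeff R = 0) : CoordRing R →ₐ[ℂ] ℂ :=
  Ideal.Quotient.liftₐ (Ideal.span {R}) (aeval (0 : Fin 2 → ℂ)) fun f hf => by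
    obtain ⟨w, rfl⟩ := Ideal.mem_span_singleton.1 hf
    simp [hconst]

theorem curveAug_mk (hconst : constantCoeff R = 0) (f : MvPolynomial (Fin 2) ℂ) :
    curveAug R hconst (Ideal.Quotient.mk _ f) = constantCoeff f := by
  simp [curveAug]

theorem cl_surjective : Function.Surjective (cl R) := by
  rintro ⟨a, ha⟩
  obtain ⟨f, hf, rfl⟩ :=
    (Ideal.mem_map_iff_of_surjective _ Ideal.Quotient.mk_surjective).1 ha
  exact ⟨⟨f, hf⟩, rfl⟩

theorem curveAug_eq_zero_iff (hconst : constantCoeff R = 0) {a : CoordRing R} :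
    curveAug R hconst a = 0 ↔ a ∈ Aplus R := by
  constructor
  · obtain ⟨f, rfl⟩ := Ideal.Quotient.mk_surjective a
    rw [curveAug_mk]
    exact fun hf => (cl R ⟨f, mem_maxIdeal.2 hf⟩).2
  · intro ha
    obtain ⟨f, hf⟩ := cl_surjective ⟨a, ha⟩
    obtain rfl : Ideal.Quotient.mk (Ideal.span {R}) f = a := congrArg Subtype.val hf
    rw [curveAug_mk, mem_maxIdeal.1 f.2]

variable (R) in
/-- `A₊` as the augmentation ideal of the coordinate algebra. -/
def curveAugmentation (hconst : constantCoeff R = 0) : Augmentation (Aplus R) (CoordRing R) where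
  incl := NonUnitalSubalgebraClass.subtype (Aplus R)
  aug := curveAug R hconst
  incl_injective := Subtype.val_injective
  exact a := (curveAug_eq_zero_iff hconst).trans
    ⟨fun ha => ⟨⟨a, ha⟩, rfl⟩, by rintro ⟨b, rfl⟩; exact b.2⟩

/-- The matrices `M_n` of polynomials attached to a decomposition `R = x₁R₁ + x₂R₂`. -/
abbrev curveMatrix (S : Fin 2 → maxIdeal) (n : ℕ) :
    Matrix (Fin 2) (Fin 2) (MvPolynomial (Fin 2) ℂ) :=
  M (MvPolynomial (Fin 2) ℂ) X (fun i => (S i : MvPolynomial (Fin 2) ℂ)) n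

theorem constantCoeff_curveMatrix (S : Fin 2 → maxIdeal) (n : ℕ) (i j : Fin 2) :
    constantCoeff (curveMatrix S n i j) = 0 := by
  have hS : ∀ i, constantCoeff (S i : MvPolynomial (Fin 2) ℂ) = 0 := fun i => mem_maxIdeal.1 (S i).2
  by_cases hn : Odd n <;> fin_cases i <;> fin_cases j <;> simp [M, hn, hS]

/-- The matrix `M_n` acting on pairs of functions on the curve `R = 0`. -/
def curveMap (R : MvPolynomial (Fin 2) ℂ) (S : Fin 2 → maxIdeal) (n : ℕ) :
    (Fin 2 → CoordRing R) →ₗ[CoordRing R] (Fin 2 → CoordRing R) :=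
  ((curveMatrix S n).map (Ideal.Quotient.mk (Ideal.span {R}))).mulVecLin

variable (R) in
/-- The map `(a₁, a₂) ↦ a₁x₁ + a₂x₂`, which is the first row of `M₀`. -/
def curveCover : (Fin 2 → CoordRing R) →ₗ[CoordRing R] CoordRing R :=
  Fintype.linearCombination (CoordRing R) fun i => Ideal.Quotient.mk _ (X i)

theorem curveCover_apply (v : Fin 2 → CoordRing R) :
    curveCover R v = v 0 * Ideal.Quotient.mk _ (X 0) + v 1 * Ideal.Quotient.mk _ (X 1) := by
  rw [curveCover, Fintype.linearCombination_apply, Fin.sum_univ_two, smul_eq_mul, smul_eq_mul]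

theorem curveAug_curveMap (hconst : constantCoeff R = 0) (S : Fin 2 → maxIdeal) (n : ℕ)
    (v : Fin 2 → CoordRing R) (i : Fin 2) : curveAug R hconst (curveMap R S n v i) = 0 := by
  simp only [curveMap, Matrix.mulVecLin_apply, Matrix.mulVec, dotProduct, Matrix.map_apply,
    map_sum, map_mul, curveAug_mk, constantCoeff_curveMatrix, zero_mul, Finset.sum_const_zero]

theorem exact_curveAug (hconst : constantCoeff R = 0) :
    Function.Exact (curveCover R) (curveAug R hconst) := by
  intro a
  rw [curveAug_eq_zero_iff]
  constructor
  · intro ha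
    obtain ⟨f, hf⟩ := cl_surjective ⟨a, ha⟩
    obtain ⟨p, q, hpq⟩ := Ideal.mem_span_pair.1 f.2
    refine ⟨![Ideal.Quotient.mk _ p, Ideal.Quotient.mk _ q], ?_⟩
    have hmk : Ideal.Quotient.mk (Ideal.span {R}) f = a := congrArg Subtype.val hf
    simp [curveCover_apply, ← hmk, ← hpq]
  · rintro ⟨v, rfl⟩
    simp [← curveAug_eq_zero_iff hconst, curveCover_apply, curveAug_mk]

section Partials

variable {S : Fin 2 → maxIdeal} (hS : ∑ i, X i * (S i : MvPolynomial (Fin 2) ℂ) = R)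

include hS

theorem curveMatrix_mul_curveMatrix (n : ℕ) :
    curveMatrix S n * curveMatrix S (n + 1) = R • 1 := by
  ext1 i j
  rw [Matrix.mul_apply, Matrix.smul_apply, Matrix.one_apply, smul_ite, smul_zero, smul_eq_mul,
    mul_one, ← hS]
  exact sum_bilin_M (β := LinearMap.mul ℂ (MvPolynomial (Fin 2) ℂ)) (fun a b => mul_comm a b)
    X _ n i j

theorem exact_curveMap (hR : R ≠ 0) (n : ℕ) :
    Function.Exact (curveMap R S (n + 1)) (curveMap R S n) := by
  refine exact_mulVecLin_of_mul_eq_smul_one (IsRegular.of_ne_zero hR).left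
    (curveMatrix_mul_curveMatrix hS n) ?_
  rw [← curveMatrix_mul_curveMatrix hS (n + 1), curveMatrix, curveMatrix, curveMatrix, M_add_two]

theorem exact_curveCover (hR : R ≠ 0) : Function.Exact (curveMap R S 1) (curveCover R) := by
  intro v
  constructor
  · intro hv
    obtain ⟨f, hf⟩ := Ideal.Quotient.mk_surjective (v 0)
    obtain ⟨g, hg⟩ := Ideal.Quotient.mk_surjective (v 1)
    rw [curveCover_apply, ← hf, ← hg, ← map_mul, ← map_mul, ← map_add, mk_eq_zero_iff] at hv
    obtain ⟨w, hw⟩ := hv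
    rw [Fin.sum_univ_two] at hS
    obtain ⟨u, hu, hu'⟩ : ∃ u, f - (S 0).1 * w = -X 1 * u ∧ g - (S 1).1 * w = X 0 * u :=
      exists_eq_mul_of_X_mul_add_X_mul_eq_zero zero_ne_one (by linear_combination hw - w * hS)
    rw [sub_eq_iff_eq_add] at hu hu'
    have hfg : (curveMatrix S 1).mulVec ![w, u] = ![f, g] := by
      ext1 i
      fin_cases i <;> simp [M, hu, hu', add_comm, mul_comm]
    refine ⟨Ideal.Quotient.mk _ ∘ ![w, u], funext fun i => ?_⟩
    rw [curveMap, Matrix.mulVecLin_apply, ← RingHom.map_mulVec, hfg]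
    fin_cases i
    exacts [hf, hg]
  · rintro ⟨y, rfl⟩
    have hcover : ∀ v, curveCover R v = curveMap R S 0 v 0 := fun v => by
      simp [curveCover_apply, curveMap, M, mul_comm]
    rw [hcover, (exact_curveMap hS hR 0).apply_apply_eq_zero, Pi.zero_apply]

/-- The resolution of `A₊` by free modules of rank two given by the matrices `M_n`. -/
def curveResolution (hR : R ≠ 0) (hconst : constantCoeff R = 0) :
    MinimalResolution (curveAugmentation R hconst) (Fin 2) where
  map s := curveMap R S (s + 1)
  cover := curveCover R
  exact_map s := exact_curveMap hS hR (s + 1)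
  exact_cover := exact_curveCover hS hR
  exact_aug := exact_curveAug hconst
  minimal s := curveAug_curveMap hconst S (s + 1)

end Partials

theorem cl_eq_zero_iff {f : maxIdeal} : cl R f = 0 ↔ ∃ w, f.1 = R * w :=
  Subtype.ext_iff.trans mk_eq_zero_iff

theorem exists_linearMap_cl {V : Type*} [AddCommGroup V] [Module ℂ V] (φ : maxIdeal →ₗ[ℂ] V)
    (hφ : ∀ f w, f.1 = R * w → φ f = 0) : ∃ ψ : Aplus R →ₗ[ℂ] V, ∀ f, ψ (cl R f) = φ f := by
  have hcl : ∀ {f g}, cl R f = cl R g → φ f = φ g := fun {f g} h => by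
    obtain ⟨w, hw⟩ := cl_eq_zero_iff (f := f - g).1 (sub_eq_zero.2 h)
    rw [← sub_eq_zero, ← map_sub, hφ _ w hw]
  let s := Function.surjInv (cl_surjective (R := R))
  have hs : ∀ a, cl R (s a) = a := Function.surjInv_eq cl_surjective
  refine ⟨⟨⟨fun a => φ (s a), fun a b => ?_⟩, fun c a => ?_⟩, fun f => hcl (hs _)⟩
  · rw [← map_add]
    exact hcl ((hs _).trans (congrArg₂ (· + ·) (hs a).symm (hs b).symm))
  · rw [← map_smul]
    exact hcl ((hs _).trans (congrArg (c • ·) (hs a).symm))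

/-- The form is `(f, g) ↦ L(fg)`, where `L` is a linear extension of `R h ↦ h(0)`. -/
theorem exists_form (hR : R ≠ 0) :
    ∃ (L : MvPolynomial (Fin 2) ℂ →ₗ[ℂ] ℂ) (β : Aplus R →ₗ[ℂ] Aplus R →ₗ[ℂ] ℂ),
      L R = 1 ∧ ∀ f g : maxIdeal, β (cl R f) (cl R g) = L (f.1 * g.1) := by
  obtain ⟨L, hL⟩ := exists_linearMap_mul_left hR
  let B : maxIdeal →ₗ[ℂ] maxIdeal →ₗ[ℂ] ℂ :=
    (LinearMap.mul ℂ (MvPolynomial (Fin 2) ℂ)).compr₂ L |>.domRestrict₁₂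
      (maxIdeal.restrictScalars ℂ) (maxIdeal.restrictScalars ℂ)
  have hB : ∀ f g w, f.1 = R * w → B f g = 0 ∧ B g f = 0 := fun f g w hf => by
    have : L (f.1 * g.1) = 0 := by
      rw [hf, mul_assoc, hL, map_mul, mem_maxIdeal.1 g.2, mul_zero]
    exact ⟨this, by rw [← this, mul_comm]; rfl⟩
  obtain ⟨B', hB'⟩ := exists_linearMap_cl (R := R) B fun f w hf =>
    LinearMap.ext fun g => (hB f g w hf).1
  obtain ⟨B'', hB''⟩ := exists_linearMap_cl (R := R) B'.flip fun f w hf =>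
    LinearMap.ext fun a => by
      obtain ⟨g, rfl⟩ := cl_surjective a
      rw [LinearMap.flip_apply, hB']
      exact (hB f g w hf).2
  refine ⟨L, B'', by simpa using hL 1, fun f g => ?_⟩
  rw [hB'', LinearMap.flip_apply, hB']
  exact congrArg L (mul_comm _ _)

theorem nonempty_detector (hR : R ≠ 0) (hconst : constantCoeff R = 0)
    (hlin : ∀ i : Fin 2, coeff (Finsupp.single i 1) R = 0) {S : Fin 2 → maxIdeal}
    (hS : ∑ i, X i * (S i : MvPolynomial (Fin 2) ℂ) = R) :
    Nonempty (Detector (fun i => cl R (coord i)) fun i => cl R (S i)) := by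
  obtain ⟨L, β, hL, hβ⟩ := exists_form hR
  have hcoeff : ∀ i, ∃ l : Aplus R →ₗ[ℂ] ℂ, ∀ f, l (cl R f) = coeff (Finsupp.single i 1) f.1 :=
    fun i => exists_linearMap_cl
      (lcoeff ℂ (Finsupp.single i 1) ∘ₗ (maxIdeal.restrictScalars ℂ).subtype) fun f w hf => by
        change coeff _ f.1 = 0
        rw [hf, coeff_single_one_mul, hconst, hlin, zero_mul, mul_zero, add_zero]
  choose l hl using hcoeff
  have cl_mul : ∀ f g : maxIdeal, cl R f * cl R g = cl R (f.1 • g) := fun f g => rfl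
  refine ⟨{ form := β, lin := l, rel := ?_, form_symm := ?_, form_mul := ?_, form_rel := ?_,
            lin_mul := ?_, lin_coord := ?_ }⟩
  · rw [Fin.sum_univ_two] at hS ⊢
    change cl R ((coord 0).1 • S 0 + (coord 1).1 • S 1) = 0
    exact cl_eq_zero_iff.2 ⟨1, hS.trans (mul_one R).symm⟩
  · simp only [cl_surjective.forall, hβ, mul_comm, implies_true]
  · simp only [cl_surjective.forall, cl_mul, hβ]
    exact fun f g h => congrArg L (mul_assoc _ _ _)
  · simp only [hβ, ← map_sum, coord, hS, hL]
  · simp only [cl_surjective.forall, cl_mul, hl]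
    intro i f g
    change coeff _ (f.1 * g.1) = 0
    rw [coeff_single_one_mul, mem_maxIdeal.1 f.2, mem_maxIdeal.1 g.2, zero_mul, zero_mul, add_zero]
  · intro i j
    simp only [hl, coord, coeff_X, Finsupp.single_left_inj one_ne_zero, eq_comm]

end CurveAlgebra

section CurveHomology

theorem weight_even_eq_left_iff {k : ℕ} (i : Fin 2) :
    weight (2 * k) i = k ↔ i ∈ Set.range fun _ : Fin 1 => (0 : Fin 2) := by
  fin_cases i <;> simp [weight]; omega

theorem weight_even_eq_right_iff {k : ℕ} (i : Fin 2) :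
    weight (2 * k) i = k + 1 ↔ i ∈ Set.range fun _ : Fin 1 => (1 : Fin 2) := by
  fin_cases i <;> simp [weight]; omega

theorem weight_even (k : ℕ) (i : Fin 2) : weight (2 * k) i = k ∨ weight (2 * k) i = k + 1 := by
  rw [weight_even_eq_left_iff, weight_even_eq_right_iff]
  fin_cases i <;> simp

theorem weight_odd {k : ℕ} (hk : 1 ≤ k) (i : Fin 2) : weight (2 * k - 1) i = k := by
  fin_cases i <;> simp [weight] <;> omega

theorem weight_odd_eq_iff {k : ℕ} (hk : 1 ≤ k) (i : Fin 2) :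
    weight (2 * k - 1) i = k ↔ i ∈ Set.range (id : Fin 2 → Fin 2) := by
  simp [weight_odd hk]

open MvPolynomial

variable {R : MvPolynomial (Fin 2) ℂ} (hR : R ≠ 0) (hconst : constantCoeff R = 0)
  (hlin : ∀ i : Fin 2, coeff (Finsupp.single i 1) R = 0)

section Partials

variable {S : Fin 2 → maxIdeal} (hS : ∑ i, X i * (S i : MvPolynomial (Fin 2) ℂ) = R)

include hR hconst hlin hS

theorem curveP_mem_cycles {n : ℕ} (hn : 1 ≤ n) (i : Fin 2) :
    curveP R S n i ∈ cycles (Aplus R) n := by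
  obtain ⟨n, rfl⟩ := Nat.exists_eq_add_of_le' hn
  obtain ⟨D⟩ := nonempty_detector hR hconst hlin hS
  rw [curveP, P_succ_eq_row]
  exact row_mem_cycles D.rel (n + 1) i

theorem exists_basis_hoch_curveP {n : ℕ} (hn : 1 ≤ n) :
    ∃ b : Module.Basis (Fin 2) ℂ (Hoch (Aplus R) n), ∀ i, b i = hochClass (Aplus R) n
      (curveP R S n i) (curveP_mem_cycles hR hconst hlin hS hn i) := by
  obtain ⟨n, rfl⟩ := Nat.exists_eq_add_of_le' hn
  obtain ⟨D⟩ := nonempty_detector hR hconst hlin hS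
  have := (curveResolution hS hR hconst).finite_hoch
  simpa only [curveP, P_succ_eq_row] using
    D.exists_basis_hoch_row (curveResolution hS hR hconst).finrank_hoch_le n

theorem exists_basis_hoch_e_curveP {n : ℕ} (hn : 1 ≤ n) :
    ∃ b : Module.Basis (Fin 2) ℂ (Hoch (Aplus R) n), ∀ i, b i = hochClass (Aplus R) n
      (e (Aplus R) n (weight n i) (curveP R S n i))
      (e_mem_cycles _ (curveP_mem_cycles hR hconst hlin hS hn i)) := by
  obtain ⟨n, rfl⟩ := Nat.exists_eq_add_of_le' hn
  obtain ⟨D⟩ := nonempty_detector hR hconst hlin hS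
  have := (curveResolution hS hR hconst).finite_hoch
  simpa only [curveP, P_succ_eq_row] using
    D.exists_basis_hoch_e_row (curveResolution hS hR hconst).finrank_hoch_le n

theorem exists_basis_hComp_curveP {κ : Type*} {n k : ℕ} (hn : 1 ≤ n) {f : κ → Fin 2}
    (hf : Function.Injective f) (hw : ∀ i, weight n i = k ↔ i ∈ Set.range f) :
    ∃ b : Module.Basis κ ℂ (HComp (Aplus R) n k), ∀ j, b j = compClass (Aplus R) n k
      (e (Aplus R) n k (curveP R S n (f j)))
      (e_mem_cyclesComp k (curveP_mem_cycles hR hconst hlin hS hn (f j))) := by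
  obtain ⟨b, hb⟩ := exists_basis_hoch_e_curveP hR hconst hlin hS hn
  exact exists_basis_hComp (curveP_mem_cycles hR hconst hlin hS hn) hb hf hw

end Partials

include hR hconst hlin

theorem subsingleton_hComp_Aplus {n k : ℕ} (hn : 1 ≤ n) (hw : ∀ i, weight n i ≠ k) :
    Subsingleton (HComp (Aplus R) n k) := by
  obtain ⟨S, hS⟩ := exists_partials hconst hlin
  obtain ⟨b, hb⟩ := exists_basis_hoch_e_curveP hR hconst hlin hS hn
  exact subsingleton_hComp (curveP_mem_cycles hR hconst hlin hS hn) hb hw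

theorem isCompl_range_toHoch_Aplus {n j k : ℕ} (hn : 1 ≤ n) (hjk : j ≠ k)
    (hw : ∀ i, weight n i = j ∨ weight n i = k) :
    IsCompl (LinearMap.range (toHoch (Aplus R) n j)) (LinearMap.range (toHoch (Aplus R) n k)) := by
  obtain ⟨S, hS⟩ := exists_partials hconst hlin
  obtain ⟨b, hb⟩ := exists_basis_hoch_e_curveP hR hconst hlin hS hn
  exact isCompl_range_toHoch (curveP_mem_cycles hR hconst hlin hS hn) hb hjk hw

theorem toHoch_Aplus_bijective {n k : ℕ} (hn : 1 ≤ n) (hw : ∀ i, weight n i = k) :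
    Function.Bijective (toHoch (Aplus R) n k) := by
  obtain ⟨S, hS⟩ := exists_partials hconst hlin
  obtain ⟨b, hb⟩ := exists_basis_hoch_e_curveP hR hconst hlin hS hn
  exact toHoch_bijective (curveP_mem_cycles hR hconst hlin hS hn) hb hw

theorem finrank_hComp_Aplus {κ : Type*} [Fintype κ] {n k : ℕ} (hn : 1 ≤ n) {f : κ → Fin 2}
    (hf : Function.Injective f) (hw : ∀ i, weight n i = k ↔ i ∈ Set.range f) :
    Module.finrank ℂ (HComp (Aplus R) n k) = Fintype.card κ := by
  obtain ⟨S, hS⟩ := exists_partials hconst hlin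
  obtain ⟨b, -⟩ := exists_basis_hComp_curveP hR hconst hlin hS hn hf hw
  exact Module.finrank_eq_card_basis b

end CurveHomology

end PlaneCurve

end

theorem theorem3p8 (R : MvPolynomial (Fin 2) ℂ) (hR : R ≠ 0)
    (hconst : MvPolynomial.constantCoeff R = 0)
    (hlin : ∀ i : Fin 2, MvPolynomial.coeff (Finsupp.single i 1) R = 0) :
    -- the decomposition of the homology
    (∀ k : ℕ, 1 ≤ k →
      -- even degrees
      (Function.Injective (PlaneCurve.toHoch (PlaneCurve.Aplus R) (2 * k) k) ∧
        Function.Injective (PlaneCurve.toHoch (PlaneCurve.Aplus R) (2 * k) (k + 1)) ∧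
        IsCompl (LinearMap.range (PlaneCurve.toHoch (PlaneCurve.Aplus R) (2 * k) k))
          (LinearMap.range (PlaneCurve.toHoch (PlaneCurve.Aplus R) (2 * k) (k + 1))) ∧
        Module.finrank ℂ (PlaneCurve.HComp (PlaneCurve.Aplus R) (2 * k) k) = 1 ∧
        Module.finrank ℂ (PlaneCurve.HComp (PlaneCurve.Aplus R) (2 * k) (k + 1)) = 1 ∧
        ∀ j : ℕ, j ≠ k → j ≠ k + 1 →
          Subsingleton (PlaneCurve.HComp (PlaneCurve.Aplus R) (2 * k) j)) ∧
      -- odd degrees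
      (Function.Bijective (PlaneCurve.toHoch (PlaneCurve.Aplus R) (2 * k - 1) k) ∧
        Module.finrank ℂ (PlaneCurve.HComp (PlaneCurve.Aplus R) (2 * k - 1) k) = 2 ∧
        ∀ j : ℕ, j ≠ k →
          Subsingleton (PlaneCurve.HComp (PlaneCurve.Aplus R) (2 * k - 1) j))) ∧
    -- the representative chains
    (∃ S : Fin 2 → PlaneCurve.maxIdeal,
      ∑ i, MvPolynomial.X i * (S i : MvPolynomial (Fin 2) ℂ) = R) ∧
    (∀ S : Fin 2 → PlaneCurve.maxIdeal,
      ∑ i, MvPolynomial.X i * (S i : MvPolynomial (Fin 2) ℂ) = R →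
      -- the two chains of each row are closed, and their classes are a basis
      (∀ n : ℕ, 1 ≤ n →
        ∃ (h : ∀ i : Fin 2, PlaneCurve.curveP R S n i ∈
              PlaneCurve.cycles (PlaneCurve.Aplus R) n)
          (b : Module.Basis (Fin 2) ℂ (PlaneCurve.Hoch (PlaneCurve.Aplus R) n)),
          ∀ i : Fin 2, b i = PlaneCurve.hochClass (PlaneCurve.Aplus R) n _ (h i)) ∧
      -- their projections are bases of the components
      (∀ k : ℕ, 1 ≤ k →
        (∃ (h : PlaneCurve.e (PlaneCurve.Aplus R) (2 * k) k (PlaneCurve.curveP R S (2 * k) 0) ∈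
              PlaneCurve.cyclesComp (PlaneCurve.Aplus R) (2 * k) k)
          (b : Module.Basis (Fin 1) ℂ (PlaneCurve.HComp (PlaneCurve.Aplus R) (2 * k) k)),
          b 0 = PlaneCurve.compClass (PlaneCurve.Aplus R) (2 * k) k _ h) ∧
        (∃ (h : PlaneCurve.e (PlaneCurve.Aplus R) (2 * k) (k + 1)
              (PlaneCurve.curveP R S (2 * k) 1) ∈
              PlaneCurve.cyclesComp (PlaneCurve.Aplus R) (2 * k) (k + 1))
          (b : Module.Basis (Fin 1) ℂ (PlaneCurve.HComp (PlaneCurve.Aplus R) (2 * k) (k + 1))),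
          b 0 = PlaneCurve.compClass (PlaneCurve.Aplus R) (2 * k) (k + 1) _ h) ∧
        (∃ (h : ∀ i : Fin 2, PlaneCurve.e (PlaneCurve.Aplus R) (2 * k - 1) k
              (PlaneCurve.curveP R S (2 * k - 1) i) ∈
              PlaneCurve.cyclesComp (PlaneCurve.Aplus R) (2 * k - 1) k)
          (b : Module.Basis (Fin 2) ℂ (PlaneCurve.HComp (PlaneCurve.Aplus R) (2 * k - 1) k)),
          ∀ i : Fin 2, b i = PlaneCurve.compClass (PlaneCurve.Aplus R) (2 * k - 1) k _ (h i)))) := by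
  open PlaneCurve in
  have hinj (i : Fin 2) : Function.Injective fun _ : Fin 1 => i :=
    Function.injective_of_subsingleton _
  refine ⟨fun k hk => ?_, exists_partials hconst hlin, fun S hS =>
    ⟨fun n hn => ⟨_, exists_basis_hoch_curveP hR hconst hlin hS hn⟩, fun k hk => ?_⟩⟩
  all_goals
    have even_pos : 1 ≤ 2 * k := by omega
    have odd_pos : 1 ≤ 2 * k - 1 := by omega
  · refine ⟨⟨toHoch_injective _ _, toHoch_injective _ _,
      isCompl_range_toHoch_Aplus hR hconst hlin even_pos (by omega) (weight_even k),
      finrank_hComp_Aplus hR hconst hlin even_pos (hinj 0) weight_even_eq_left_iff,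
      finrank_hComp_Aplus hR hconst hlin even_pos (hinj 1) weight_even_eq_right_iff,
      fun j _ _ => subsingleton_hComp_Aplus hR hconst hlin even_pos fun i _ => ?_⟩,
      toHoch_Aplus_bijective hR hconst hlin odd_pos (weight_odd hk),
      finrank_hComp_Aplus hR hconst hlin odd_pos Function.injective_id (weight_odd_eq_iff hk),
      fun j hj => subsingleton_hComp_Aplus hR hconst hlin odd_pos fun i _ => ?_⟩
    · have := weight_even k i
      omega
    · have := weight_odd hk i
      omega
  · obtain ⟨b, hb⟩ := exists_basis_hComp_curveP hR hconst hlin hS even_pos (hinj 0)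
      weight_even_eq_left_iff
    obtain ⟨b', hb'⟩ := exists_basis_hComp_curveP hR hconst hlin hS even_pos (hinj 1)
      weight_even_eq_right_iff
    exact ⟨⟨_, b, hb 0⟩, ⟨_, b', hb' 0⟩, _, exists_basis_hComp_curveP hR hconst hlin hS odd_pos
      Function.injective_id (weight_odd_eq_iff hk)⟩
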